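/- Let $T\ge 1$ and consider the CES skill-formation model with positive latent skills $\theta_0,\dots,\theta_T$, positive latent investments $I_0,\dots,I_{T-1}$ and positive observed incomes $Y_0,\dots,Y_{T-1}$: $$\theta_{t+1}=(\gamma_{1t}\theta_t^{\sigma_t}+\gamma_{2t}I_t^{\sigma_t})^{\psi_t/\sigma_t}\exp(\eta_{\theta,t}),\qquad \ln I_t=\beta_{0t}+\beta_{1t}\ln\theta_t+\beta_{2t}\ln Y_t+\eta_{I,t}\qquad(0\le t\le T-1),$$ $$Z_{\theta,t,m}=\mu_{\theta,t,m}+\lambda_{\theta,t,m}\ln\theta_t+\varepsilon_{\theta,t,m}\ (0\le t\le T),\qquad Z_{I,t,m}=\mu_{I,t,m}+\lambda_{I,t,m}\ln I_t+\varepsilon_{I,t,m}\ (0\le t\le T-1),\qquad m=1,2,$$ $$Q=\rho_0+\rho_1\ln\theta_T+\eta_Q .$$ The observables are all $Z_{\theta,t,m}$, $Z_{I,t,m}$, $Y_t$ and $Q$. The parameter space consists of all real vectors $(\mu_{\theta,t,m},\lambda_{\theta,t,m},\mu_{I,t,m},\lambda_{I,t,m},\rho_0,\rho_1,\beta_{0t},\beta_{1t},\beta_{2t},\gamma_{1t},\gamma_{2t},\sigma_t,\psi_t)$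 with $\lambda_{\theta,t,m},\lambda_{I,t,m}\neq0$, $\gamma_{1t},\gamma_{2t}>0$, $\sigma_t,\psi_t\ne0$ for all $t,m$, and $(\beta_{1t},\beta_{2t})\neq(-1,0)$ for all $t$ (which holds in particular whenever income affects investment, $\beta_{2t}\ne0$). Assumption 1. Write $Y=(Y_0,\dots,Y_{T-1})$ and call the variables $\varepsilon_{\theta,t,m},\varepsilon_{I,t,m},\eta_Q$ the errors. (a) Conditional on $Y$, the errors are jointly independent, and they are independent of $(\{\theta_t\}_t,\{I_t\}_t)$. (b) $\ln\theta_t$, $\ln I_t$, $\ln Y_t$, the errors, $\eta_{\theta,t}$ and $\eta_{I,t}$ have finite first and second moments. (c) Each error has conditional mean zero given $Y$. (d) All loadings $\lambda_{\theta,t,m},\lambda_{I,t,m}$ are nonzero. (e) Each $\ln\theta_t$ has nonzero covariance with some $\ln I_s$ or with some $\ln\theta_s$, $s\ne t$; each $\ln I_t$ has nonzero covariance with some $\ln\theta_s$ or with some $\ln I_s$, $s\neq t$. (f) For each error, for almost every value of $Y$, the real zeros of its conditional characteristic function given $Y$ are isolated and distinct from the zeros of the derivative of that function. (g) For each $t\le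 T-1$, the support of $(\theta_t,I_t,Y_t)$ includes an open ball in $\mathbb R^3$. (h) For each $t\le T-1$, $E[\eta_{\theta,t}\mid\theta_t,Y_t]=0$, $E[\eta_{I,t}\mid\theta_t,Y_t]=0$ and $E[\eta_{\theta,t}\mid\theta_t,\eta_{I,t},Y_t]=\kappa_t\eta_{I,t}$ for some constant $\kappa_t$. Define the transformed parameters $$\tilde\lambda_{\theta,t,m}=\frac{\lambda_{\theta,t,m}}{\lambda_{\theta,t,1}},\quad \tilde\mu_{\theta,t,m}=\mu_{\theta,t,m}-\frac{\lambda_{\theta,t,m}}{\lambda_{\theta,t,1}}\mu_{\theta,t,1},\quad \tilde\lambda_{I,t,m}=\frac{\lambda_{I,t,m}}{\lambda_{I,t,1}},\quad \tilde\mu_{I,t,m}=\mu_{I,t,m}-\frac{\lambda_{I,t,m}}{\lambda_{I,t,1}}\mu_{I,t,1},$$ $$\tilde\rho_0=\rho_0-\frac{\rho_1\mu_{\theta,T,1}}{\lambda_{\theta,T,1}},\quad\tilde\rho_1=\frac{\rho_1}{\lambda_{\theta,T,1}},\quad \tilde\beta_{0t}=\lambda_{I,t,1}\beta_{0t}+\mu_{I,t,1}-\frac{\lambda_{I,t,1}}{\lambda_{\theta,t,1}}\mu_{\theta,t,1}\beta_{1t},\quad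 \tilde\beta_{1t}=\frac{\lambda_{I,t,1}}{\lambda_{\theta,t,1}}\beta_{1t},\quad\tilde\beta_{2t}=\lambda_{I,t,1}\beta_{2t},$$ $$\tilde\gamma_{1t}=\gamma_{1t}\exp\Big(\sigma_t\Big(\frac{\mu_{\theta,t+1,1}}{\psi_t\lambda_{\theta,t+1,1}}-\frac{\mu_{\theta,t,1}}{\lambda_{\theta,t,1}}\Big)\Big),\qquad \tilde\gamma_{2t}=\gamma_{2t}\exp\Big(\sigma_t\Big(\frac{\mu_{\theta,t+1,1}}{\psi_t\lambda_{\theta,t+1,1}}-\frac{\mu_{I,t,1}}{\lambda_{I,t,1}}\Big)\Big),$$ together with $\sigma_t/\lambda_{\theta,t,1}$, $\sigma_t/\lambda_{I,t,1}$ and $\lambda_{\theta,t+1,1}\psi_t/\sigma_t$. Theorem. Let the data be generated by the model at a parameter vector $p_0$ of the parameter space, with Assumption 1 satisfied. The identified set is the set of all vectors of the parameter space that, for some choice of random variables satisfying the model equations and Assumption 1, generate the same joint distribution of the observables. Then: (a) the identified set consists of exactly those vectors of the parameter space that yield the same values of all transformed parameters as $p_0$; (b) consequently $\lambda_{\theta,t,1}/\lambda_{I,t,1}$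 is point identified for every $t=0,\dots,T-1$: it takes the same value at all vectors of the identified set; (c) for all fixed constants $\bar\mu_{\theta,t,1}$, $\bar\lambda_{\theta,t,1}\neq0$ ($0\le t\le T$) and $\bar\mu_{I,t,1}$ ($0\le t\le T-1$), the identified set under the additional restrictions $\mu_{\theta,t,1}=\bar\mu_{\theta,t,1}$, $\mu_{I,t,1}=\bar\mu_{I,t,1}$ and $\lambda_{\theta,t,1}=\bar\lambda_{\theta,t,1}$ for all $t$ is a singleton. -/

import Mathlib

open MeasureTheory ProbabilityTheory Filter Topology

/-- The finite-dimensional parameters of the CES skill-formation model with periods `0, …, T`.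
The two measures of a latent variable are indexed by `Fin 2`; the index `0` is the first measure. -/
@[ext]
structure CESParams (T : ℕ) where
  /-- intercepts of the skill measures -/
  muθ : Fin (T + 1) → Fin 2 → ℝ
  /-- loadings of the skill measures -/
  lamθ : Fin (T + 1) → Fin 2 → ℝ
  /-- intercepts of the investment measures -/
  muI : Fin T → Fin 2 → ℝ
  /-- loadings of the investment measures -/
  lamI : Fin T → Fin 2 → ℝ
  ρ0 : ℝ
  ρ1 : ℝ
  β0 : Fin T → ℝ
  β1 : Fin T → ℝ
  β2 : Fin T → ℝ
  γ1 : Fin T → ℝ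
  γ2 : Fin T → ℝ
  σ : Fin T → ℝ
  ψ : Fin T → ℝ

/-- The parameter space. The last condition excludes only the knife-edge case in which income does
not affect investment and the skill elasticity of investment is exactly `-1`. -/
structure CESParams.Admissible {T : ℕ} (p : CESParams T) : Prop where
  lamθ_ne : ∀ t m, p.lamθ t m ≠ 0
  lamI_ne : ∀ t m, p.lamI t m ≠ 0
  γ1_pos : ∀ t, 0 < p.γ1 t
  γ2_pos : ∀ t, 0 < p.γ2 t
  σ_ne : ∀ t, p.σ t ≠ 0
  ψ_ne : ∀ t, p.ψ t ≠ 0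
  relevance : ∀ t, p.β2 t = 0 → p.β1 t ≠ -1

/-- The parameters of the model rewritten in terms of
`θ̃ₜ = exp (μ_{θ,t,1}) θₜ ^ λ_{θ,t,1}` and `Ĩₜ = exp (μ_{I,t,1}) Iₜ ^ λ_{I,t,1}`. -/
@[ext]
structure CESTransformed (T : ℕ) where
  muθ : Fin (T + 1) → Fin 2 → ℝ
  lamθ : Fin (T + 1) → Fin 2 → ℝ
  muI : Fin T → Fin 2 → ℝ
  lamI : Fin T → Fin 2 → ℝ
  ρ0 : ℝ
  ρ1 : ℝ
  β0 : Fin T → ℝ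
  β1 : Fin T → ℝ
  β2 : Fin T → ℝ
  γ1 : Fin T → ℝ
  γ2 : Fin T → ℝ
  /-- exponent of `θ̃ₜ` -/
  expθ : Fin T → ℝ
  /-- exponent of `Ĩₜ` -/
  expI : Fin T → ℝ
  /-- outer exponent -/
  expOut : Fin T → ℝ

/-- The transformed parameters as functions of the primitive ones. -/
noncomputable def CESParams.transformed {T : ℕ} (p : CESParams T) : CESTransformed T where
  muθ t m := p.muθ t m - p.lamθ t m / p.lamθ t 0 * p.muθ t 0
  lamθ t m := p.lamθ t m / p.lamθ t 0
  muI t m := p.muI t m - p.lamI t m / p.lamI t 0 * p.muI t 0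
  lamI t m := p.lamI t m / p.lamI t 0
  ρ0 := p.ρ0 - p.ρ1 * p.muθ (Fin.last T) 0 / p.lamθ (Fin.last T) 0
  ρ1 := p.ρ1 / p.lamθ (Fin.last T) 0
  β0 t := p.lamI t 0 * p.β0 t + p.muI t 0
    - p.lamI t 0 / p.lamθ t.castSucc 0 * p.muθ t.castSucc 0 * p.β1 t
  β1 t := p.lamI t 0 / p.lamθ t.castSucc 0 * p.β1 t
  β2 t := p.lamI t 0 * p.β2 t
  γ1 t := p.γ1 t * Real.exp (p.σ t *
    (p.muθ t.succ 0 / (p.ψ t * p.lamθ t.succ 0) - p.muθ t.castSucc 0 / p.lamθ t.castSucc 0))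
  γ2 t := p.γ2 t * Real.exp (p.σ t *
    (p.muθ t.succ 0 / (p.ψ t * p.lamθ t.succ 0) - p.muI t 0 / p.lamI t 0))
  expθ t := p.σ t / p.lamθ t.castSucc 0
  expI t := p.σ t / p.lamI t 0
  expOut t := p.lamθ t.succ 0 * p.ψ t / p.σ t

/-- The random variables of the model: skills, investment, income, measurement errors
and shocks. Skills, investment and income are positive. -/
structure SkillVars (T : ℕ) (Ω : Type) [MeasurableSpace Ω] where
  θ : Fin (T + 1) → Ω → ℝ
  inv : Fin T → Ω → ℝ
  Y : Fin T → Ω → ℝ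
  εθ : Fin (T + 1) → Fin 2 → Ω → ℝ
  εI : Fin T → Fin 2 → Ω → ℝ
  ηQ : Ω → ℝ
  ηθ : Fin T → Ω → ℝ
  ηI : Fin T → Ω → ℝ
  measurable_θ : ∀ t, Measurable (θ t)
  measurable_inv : ∀ t, Measurable (inv t)
  measurable_Y : ∀ t, Measurable (Y t)
  measurable_εθ : ∀ t m, Measurable (εθ t m)
  measurable_εI : ∀ t m, Measurable (εI t m)
  measurable_ηQ : Measurable ηQ
  measurable_ηθ : ∀ t, Measurable (ηθ t)
  measurable_ηI : ∀ t, Measurable (ηI t)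
  θ_pos : ∀ t ω, 0 < θ t ω
  inv_pos : ∀ t ω, 0 < inv t ω
  Y_pos : ∀ t ω, 0 < Y t ω

/-- The values of the observed variables: skill measures, investment measures, income and the
adult outcome. -/
abbrev SkillData (T : ℕ) : Type :=
  (Fin (T + 1) → Fin 2 → ℝ) × (Fin T → Fin 2 → ℝ) × (Fin T → ℝ) × ℝ

/-- Index set of the measurement errors `ε_{θ,t,m}`, `ε_{I,t,m}` and of `η_Q`. -/
abbrev ErrIdx (T : ℕ) : Type := (Fin (T + 1) × Fin 2) ⊕ (Fin T × Fin 2) ⊕ Unit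

namespace SkillVars

variable {T : ℕ} {Ω : Type} [MeasurableSpace Ω]

/-- log skills -/
noncomputable def logθ (v : SkillVars T Ω) (t : Fin (T + 1)) (ω : Ω) : ℝ := Real.log (v.θ t ω)

/-- log investment -/
noncomputable def logI (v : SkillVars T Ω) (t : Fin T) (ω : Ω) : ℝ := Real.log (v.inv t ω)

/-- log income -/
noncomputable def logY (v : SkillVars T Ω) (t : Fin T) (ω : Ω) : ℝ := Real.log (v.Y t ω)

/-- The observed variables: the measures of skills and of investment, income, and the adult
outcome `Q`, generated by the measurement equations and the outcome equation. -/
noncomputable def observed (v : SkillVars T Ω) (p : CESParams T) (ω : Ω) : SkillData T :=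
  (fun t m => p.muθ t m + p.lamθ t m * v.logθ t ω + v.εθ t m ω,
   fun t m => p.muI t m + p.lamI t m * v.logI t ω + v.εI t m ω,
   fun t => v.Y t ω,
   p.ρ0 + p.ρ1 * v.logθ (Fin.last T) ω + v.ηQ ω)

/-- All measurement errors together with the outcome error. -/
def err (v : SkillVars T Ω) : ErrIdx T → Ω → ℝ
  | .inl (t, m) => v.εθ t m
  | .inr (.inl (t, m)) => v.εI t m
  | .inr (.inr _) => v.ηQ

/-- The income history. -/
def income (v : SkillVars T Ω) (ω : Ω) : Fin T → ℝ := fun t => v.Y t ω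

/-- The histories of skills and investment. -/
def latent (v : SkillVars T Ω) (ω : Ω) : (Fin (T + 1) → ℝ) × (Fin T → ℝ) :=
  (fun t => v.θ t ω, fun t => v.inv t ω)

/-- The σ-algebra generated by the income history. -/
abbrev incomeσ (v : SkillVars T Ω) : MeasurableSpace Ω :=
  MeasurableSpace.comap v.income inferInstance

theorem measurable_income (v : SkillVars T Ω) : Measurable v.income :=
  measurable_pi_lambda _ v.measurable_Y

theorem incomeσ_le (v : SkillVars T Ω) : v.incomeσ ≤ ‹MeasurableSpace Ω› :=
  v.measurable_income.comap_le

/-- The production technology and the investment equation. -/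
structure Equations (v : SkillVars T Ω) (p : CESParams T) : Prop where
  production : ∀ t ω, v.θ t.succ ω =
    (p.γ1 t * v.θ t.castSucc ω ^ p.σ t + p.γ2 t * v.inv t ω ^ p.σ t) ^ (p.ψ t / p.σ t)
      * Real.exp (v.ηθ t ω)
  investment : ∀ t ω, v.logI t ω =
    p.β0 t + p.β1 t * v.logθ t.castSucc ω + p.β2 t * v.logY t ω + v.ηI t ω

end SkillVars

/-- The zeros of the characteristic function are isolated and are not zeros of its derivative. -/
def CharFunRegular (ν : Measure ℝ) : Prop :=
  ∀ s : ℝ, charFun ν s = 0 →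
    (∀ᶠ s' in 𝓝[≠] s, charFun ν s' ≠ 0) ∧ deriv (charFun ν) s ≠ 0

/-- The stochastic assumptions of the model. (That the loadings do not vanish is part of
`CESParams.Admissible`.) -/
structure BaselineAssumption {T : ℕ} {Ω : Type} [MeasurableSpace Ω] [StandardBorelSpace Ω]
    (v : SkillVars T Ω) (μ : Measure Ω) [IsProbabilityMeasure μ] : Prop where
  /-- Given income, the errors are jointly independent … -/
  err_indep : iCondIndepFun v.incomeσ v.incomeσ_le v.err μ
  /-- … and independent of the skill and investment histories. -/
  err_latent_indep :
    CondIndepFun v.incomeσ v.incomeσ_le (fun ω i => v.err i ω) v.latent μ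
  /-- finite first and second moments of all variables in the log-linear system -/
  memLp_logθ : ∀ t, MemLp (v.logθ t) 2 μ
  memLp_logI : ∀ t, MemLp (v.logI t) 2 μ
  memLp_logY : ∀ t, MemLp (v.logY t) 2 μ
  memLp_err : ∀ i, MemLp (v.err i) 2 μ
  memLp_ηθ : ∀ t, MemLp (v.ηθ t) 2 μ
  memLp_ηI : ∀ t, MemLp (v.ηI t) 2 μ
  /-- the errors have mean zero given income -/
  err_mean : ∀ i, μ[v.err i | v.incomeσ] =ᵐ[μ] 0
  /-- every log skill is correlated with some other latent variable -/
  cov_θ : ∀ t, (∃ s, covariance (v.logθ t) (v.logI s) μ ≠ 0) ∨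
    ∃ s, s ≠ t ∧ covariance (v.logθ t) (v.logθ s) μ ≠ 0
  /-- every log investment is correlated with some other latent variable -/
  cov_I : ∀ t, (∃ s, covariance (v.logI t) (v.logθ s) μ ≠ 0) ∨
    ∃ s, s ≠ t ∧ covariance (v.logI t) (v.logI s) μ ≠ 0
  /-- regularity of the characteristic functions of the errors given income -/
  err_charFun : ∀ i, ∀ᵐ y ∂(μ.map v.income), CharFunRegular (condDistrib (v.err i) v.income μ y)
  /-- the support of `(θₜ, Iₜ, Yₜ)` includes an open ball -/
  support_ball : ∀ t : Fin T, ∃ c : ℝ × ℝ × ℝ, ∃ r > 0, Metric.ball c r ⊆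
    (μ.map (fun ω => (v.θ t.castSucc ω, v.inv t ω, v.Y t ω))).support
  /-- the production shock has mean zero given skills and income -/
  ηθ_mean : ∀ t : Fin T, μ[v.ηθ t |
    MeasurableSpace.comap (fun ω => (v.θ t.castSucc ω, v.Y t ω)) inferInstance] =ᵐ[μ] 0
  /-- linear control function -/
  ηθ_control : ∃ κ : Fin T → ℝ, ∀ t : Fin T, μ[v.ηθ t |
    MeasurableSpace.comap (fun ω => (v.θ t.castSucc ω, v.ηI t ω, v.Y t ω)) inferInstance]
      =ᵐ[μ] fun ω => κ t * v.ηI t ω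
  /-- the investment equation is a regression equation; this is implied by the two
  preceding conditions at every `t` with `κ t ≠ 0` -/
  ηI_mean : ∀ t : Fin T, μ[v.ηI t |
    MeasurableSpace.comap (fun ω => (v.θ t.castSucc ω, v.Y t ω)) inferInstance] =ᵐ[μ] 0

/-- The identified set given the distribution `P` of the observables: all admissible parameters
for which some choice of random variables that satisfies the model equations and the
assumptions generates `P`. -/
def identifiedSet {T : ℕ} (P : Measure (SkillData T)) : Set (CESParams T) :=
  {p | p.Admissible ∧
    ∃ (Ω : Type) (_ : MeasurableSpace Ω) (_ : StandardBorelSpace Ω) (μ : Measure Ω)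
      (_ : IsProbabilityMeasure μ) (v : SkillVars T Ω),
      v.Equations p ∧ BaselineAssumption v μ ∧ μ.map (v.observed p) = P}

-- The proof works with normalised logs: each log latent variable is replaced by the systematic part
-- of its first measure, `μ + λ * log`. In these units the first measure is the latent variable plus
-- noise, and all equations of the model involve only the transformed parameters, up to the scale of
-- the shocks. Two admissible vectors with the same transformed parameters are therefore
-- indistinguishable: `SkillVars.rescale` changes the units of the latent variables on the same
-- probability space, leaving the observables pointwise unchanged and the assumptions intact.
--
-- Conversely, let two structures generate the same observables. Ratios of covariances, together
-- with means, give the relative loadings and intercepts, with `Q` treated as one more measure of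
-- final skill (`measurement_eq`). Conditionally on income, the two measures of a latent variable
-- with characteristic function `a` lead to the products `a (s + t) * (e₁ s * e₂ t)`. These
-- determine the law of the first error even if `a` vanishes away from zero, because the zeros of
-- the error characteristic functions are isolated and simple (`eq_of_add_mul_mul_eq`). Dividing out
-- the first errors yields the joint law of income and all normalised latent variables
-- (`latent_law_eq`, `normLatent_law_eq`).
--
-- Given this law, the investment equation and, with the control function, the production equation
-- are regressions. The two regression functions agree almost surely (`regression_ae_eq`), hence, by
-- continuity and the support condition, on an open set (`exists_eventually_eq_zero`). The affine
-- investment equation is then determined. For production, two log CES functions differ by a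
-- multiple of the investment residual. The derivative of each in log skill is a logistic curve, and
-- two such curves differ by a constant only if they coincide or are reflections of each other
-- (`sigmoid_relation`). A reflection would make the residual proportional to an affine function of
-- log skill and log investment, which forces `β2 = 0` and `β1 = -1`, the excluded case
-- (`ces_unique`).
--
-- The ratio of loadings in (b) is a ratio of two transformed exponents. For (c), fixing the skill
-- loadings recovers `σ` from the skill exponent, then the investment loadings and `ψ`, and then all
-- the rest; this inverse is `CESTransformed.solve`.

-- A functional equation for characteristic functions.

/-- A continuous function on the line whose derivative vanishes off a set of isolated points is
constant. -/
theorem eq_of_deriv_eq_zero_off_isolated {r : ℝ → ℂ} (hr : Continuous r)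
    (h : ∀ x, ∀ᶠ y in 𝓝[≠] x, HasDerivAt r 0 y) (x y : ℝ) : r x = r y := by
  have hloc : IsLocallyConstant r := by
    refine (IsLocallyConstant.iff_eventually_eq r).2 fun x => ?_
    obtain ⟨ε, hε, hb⟩ := Metric.mem_nhdsWithin_iff.1 (h x)
    -- A one-sided interval avoids `x`, so `r` is constant there; the constant is `r x` since `x` is
    -- in the closure.
    have side : ∀ s : Set ℝ, IsOpen s → IsPreconnected s → (s ⊆ Metric.ball x ε ∩ {x}ᶜ) →
        x ∈ closure s → ∀ y ∈ s, r y = r x := by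
      intro s hs hsp hsb hx y hy
      have hc : ∀ z ∈ s, r z = r y := fun z hz =>
        hs.is_const_of_deriv_eq_zero hsp
          (fun w hw => (hb (hsb hw)).differentiableAt.differentiableWithinAt)
          (fun w hw => (hb (hsb hw)).deriv) hz hy
      have : x ∈ closure {z | r z = r y} := closure_mono hc hx
      rw [(isClosed_eq hr continuous_const).closure_eq] at this
      exact this.symm
    filter_upwards [Metric.ball_mem_nhds x hε] with y hy
    rw [Metric.mem_ball, Real.dist_eq, abs_lt] at hy
    rcases lt_trichotomy y x with hxy | hxy | hxy
    · refine side (Set.Ioo (x - ε) x) isOpen_Ioo isPreconnected_Ioo ?_ ?_ y ⟨by linarith, hxy⟩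
      · intro z hz
        refine ⟨?_, hz.2.ne⟩
        rw [Metric.mem_ball, Real.dist_eq, abs_lt]
        constructor <;> linarith [hz.1, hz.2]
      · rw [closure_Ioo (by linarith)]
        exact ⟨by linarith, le_rfl⟩
    · rw [hxy]
    · refine side (Set.Ioo x (x + ε)) isOpen_Ioo isPreconnected_Ioo ?_ ?_ y ⟨hxy, by linarith⟩
      · intro z hz
        refine ⟨?_, hz.1.ne'⟩
        rw [Metric.mem_ball, Real.dist_eq, abs_lt]
        constructor <;> linarith [hz.1, hz.2]
      · rw [closure_Ioo (by linarith)]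
        exact ⟨le_rfl, by linarith⟩
  exact hloc.apply_eq_of_isPreconnected isPreconnected_univ (Set.mem_univ x) (Set.mem_univ y)

/-- Two functions with simple isolated zeros, the same zeros and vanishing Wronskian agree once
they agree at a point where they do not vanish. -/
theorem eq_of_wronskian_eq_zero {e E : ℝ → ℂ} (he : Differentiable ℝ e) (hE : Differentiable ℝ E)
    (hzero : ∀ s, e s = 0 ↔ E s = 0) (hiso : ∀ s, ∀ᶠ s' in 𝓝[≠] s, E s' ≠ 0)
    (hsE : ∀ s, E s = 0 → deriv E s ≠ 0)
    (hw : ∀ s, deriv e s * E s = e s * deriv E s) {x₀ : ℝ} (h₀ : e x₀ = E x₀) (h₀' : E x₀ ≠ 0) :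
    e = E := by
  classical
  -- The quotient `e / E`, with the l'Hôpital value at the common zeros; simplicity of the zeros of
  -- `E` makes it continuous there.
  set r : ℝ → ℂ := fun x => if E x = 0 then deriv e x / deriv E x else e x / E x with hrdef
  have hreq : ∀ x, E x ≠ 0 → r =ᶠ[𝓝 x] fun y => e y / E y := by
    intro x hx
    filter_upwards [hE.continuous.continuousAt.eventually_ne hx] with y hy
    simp [hrdef, hy]
  have hcont : Continuous r := by
    refine continuous_iff_continuousAt.2 fun x => ?_
    by_cases hx : E x = 0
    · rw [continuousAt_iff_punctured_nhds]
      have hex := (hzero x).2 hx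
      have hlim : Tendsto (fun y => slope e x y / slope E x y) (𝓝[≠] x)
          (𝓝 (deriv e x / deriv E x)) :=
        ((hasDerivAt_iff_tendsto_slope.1 (he x).hasDerivAt).div
          (hasDerivAt_iff_tendsto_slope.1 (hE x).hasDerivAt) (hsE x hx))
      have hrx : r x = deriv e x / deriv E x := by simp [hrdef, hx]
      rw [hrx]
      refine hlim.congr' ?_
      filter_upwards [hiso x, self_mem_nhdsWithin] with y hy hyx
      have hyx' : ((y - x : ℝ) : ℂ) ≠ 0 := by
        exact_mod_cast sub_ne_zero.2 hyx
      simp only [hrdef, hy, if_false, slope_def_module, hex, hx, sub_zero]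
      rw [Complex.real_smul, Complex.real_smul, mul_div_mul_left]
      push_cast
      exact inv_ne_zero (by exact_mod_cast hyx')
    · exact ((he x).continuousAt.div (hE x).continuousAt hx).congr (hreq x hx).symm
  have hderiv : ∀ x, ∀ᶠ y in 𝓝[≠] x, HasDerivAt r 0 y := by
    intro x
    filter_upwards [hiso x] with y hy
    have := ((he y).hasDerivAt.div (hE y).hasDerivAt hy).congr_of_eventuallyEq (hreq y hy)
    rwa [hw y, sub_self, zero_div] at this
  have hone : ∀ x, r x = 1 := by
    intro x
    rw [eq_of_deriv_eq_zero_off_isolated hcont hderiv x x₀]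
    simp [hrdef, h₀', h₀]
  funext x
  by_cases hx : E x = 0
  · rw [hx, (hzero x).2 hx]
  · have := hone x
    simp only [hrdef, hx, if_false] at this
    exact (div_eq_one_iff_eq hx).1 this

/-- A nonempty open set of reals meets the complement of a set of isolated points. -/
theorem exists_mem_open_of_eventually_nhdsNE {p : ℝ → Prop} (hp : ∀ s, ∀ᶠ s' in 𝓝[≠] s, p s')
    {U : Set ℝ} (hU : IsOpen U) (hne : U.Nonempty) : ∃ t ∈ U, p t := by
  obtain ⟨u, hu⟩ := hne
  have h1 : ∀ᶠ t in 𝓝[≠] u, t ∈ U := nhdsWithin_le_nhds (hU.mem_nhds hu)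
  exact (h1.and (hp u)).exists

/-- The functional equation behind identification from two error-ridden measures
of the same variable. -/
theorem eq_of_add_mul_mul_eq {a A e₁ E₁ e₂ E₂ : ℝ → ℂ}
    (ha : ContinuousAt a 0) (hA : ContinuousAt A 0) (ha0 : a 0 ≠ 0) (hA0 : A 0 ≠ 0)
    (he₁ : Differentiable ℝ e₁) (hE₁ : Differentiable ℝ E₁)
    (he₂ : Differentiable ℝ e₂) (hE₂ : Differentiable ℝ E₂)
    (h0 : e₁ 0 = E₁ 0) (h0' : E₁ 0 ≠ 0) (hd0 : deriv e₁ 0 = deriv E₁ 0)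
    (ie₁ : ∀ s, ∀ᶠ s' in 𝓝[≠] s, e₁ s' ≠ 0) (iE₁ : ∀ s, ∀ᶠ s' in 𝓝[≠] s, E₁ s' ≠ 0)
    (ie₂ : ∀ s, ∀ᶠ s' in 𝓝[≠] s, e₂ s' ≠ 0) (iE₂ : ∀ s, ∀ᶠ s' in 𝓝[≠] s, E₂ s' ≠ 0)
    (sE₁ : ∀ s, E₁ s = 0 → deriv E₁ s ≠ 0)
    (h : ∀ s t, a (s + t) * (e₁ s * e₂ t) = A (s + t) * (E₁ s * E₂ t)) : e₁ = E₁ := by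
  obtain ⟨δ, hδ, hball⟩ : ∃ δ > 0, ∀ x, |x| < δ → a x ≠ 0 ∧ A x ≠ 0 := by
    obtain ⟨δ, hδ, hb⟩ := Metric.eventually_nhds_iff.1 ((ha.eventually_ne ha0).and
      (hA.eventually_ne hA0))
    exact ⟨δ, hδ, fun x hx => hb (by simpa [Real.dist_eq] using hx)⟩
  have i₁ := fun s => (ie₁ s).and (iE₁ s)
  have i₂ := fun s => (ie₂ s).and (iE₂ s)
  have hopen : ∀ s c : ℝ, IsOpen {t | |s + t| < c} := fun s c =>
    isOpen_lt (by fun_prop) continuous_const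
  -- Taking `t` close to `-s` keeps `s + t` where `a` and `A` do not vanish, and `t` can avoid the
  -- zeros of `e₂` and `E₂`.
  have hzero : ∀ s, e₁ s = 0 ↔ E₁ s = 0 := by
    intro s
    obtain ⟨t, ht, h1, h2⟩ := exists_mem_open_of_eventually_nhdsNE i₂ (hopen s δ)
      ⟨-s, by simpa using hδ⟩
    obtain ⟨hat, hAt⟩ := hball _ ht
    have := h s t
    constructor
    · intro h3
      rw [h3] at this
      simpa [hAt, h2] using this.symm
    · intro h3
      rw [h3] at this
      simpa [hat, h1] using this
  -- Differentiation along the antidiagonal `(s - x, t + x)` leaves `s + t` fixed, so no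
  -- differentiability of `a` or `A` is needed.
  have hD : ∀ s t, a (s + t) * (-deriv e₁ s * e₂ t + e₁ s * deriv e₂ t) =
      A (s + t) * (-deriv E₁ s * E₂ t + E₁ s * deriv E₂ t) := by
    intro s t
    have key : ∀ {f g : ℝ → ℂ} (c : ℂ), Differentiable ℝ f → Differentiable ℝ g →
        HasDerivAt (fun x : ℝ => c * (f (s - x) * g (t + x)))
          (c * (-deriv f s * g t + f s * deriv g t)) 0 := by
      intro f g c hf hg
      have h1 : HasDerivAt (fun x : ℝ => f (s - x)) (-deriv f s) 0 :=
        HasDerivAt.comp_const_sub s 0 (by rw [sub_zero]; exact (hf s).hasDerivAt)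
      have h2 : HasDerivAt (fun x : ℝ => g (t + x)) (deriv g t) 0 :=
        HasDerivAt.comp_const_add t 0 (by rw [add_zero]; exact (hg t).hasDerivAt)
      simpa using (h1.mul h2).const_mul c
    have hfun : (fun x : ℝ => a (s + t) * (e₁ (s - x) * e₂ (t + x))) =
        fun x : ℝ => A (s + t) * (E₁ (s - x) * E₂ (t + x)) := by
      funext x
      have := h (s - x) (t + x)
      rwa [show s - x + (t + x) = s + t by ring] at this
    have h1 := key (a (s + t)) he₁ he₂
    rw [hfun] at h1
    exact h1.unique (key (A (s + t)) hE₁ hE₂)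
  set w₁ : ℝ → ℂ := fun s => deriv e₁ s * E₁ s - e₁ s * deriv E₁ s with hw₁
  set w₂ : ℝ → ℂ := fun s => deriv e₂ s * E₂ s - e₂ s * deriv E₂ s with hw₂
  -- Eliminating `a` and `A` between the equation and its derivative leaves a relation between the
  -- two Wronskians.
  have hW : ∀ s t, |s + t| < δ → w₁ s * (e₂ t * E₂ t) = e₁ s * E₁ s * w₂ t := by
    intro s t hst
    refine mul_left_cancel₀ (hball _ hst).1 ?_
    have h1 := h s t
    have h2 := hD s t
    simp only [hw₁, hw₂]
    linear_combination (-(E₁ s * E₂ t)) * h2 + (-deriv E₁ s * E₂ t + E₁ s * deriv E₂ t) * h1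
  -- A common `t` near the midpoint `-(s + s') / 2` carries the vanishing from `w₁ s` to `w₂ t` and
  -- back to `w₁ s'`.
  have hstep : ∀ s s', |s - s'| < δ → e₁ s ≠ 0 → w₁ s = 0 → w₁ s' = 0 := by
    intro s s' hss hs hw
    have hs' := mt (hzero s).2 hs
    obtain ⟨t, ⟨ht, ht'⟩, h1, h2⟩ := exists_mem_open_of_eventually_nhdsNE i₂
      ((hopen s δ).inter (hopen s' δ)) ⟨-(s + s') / 2, by
        rw [abs_lt] at hss
        constructor <;> simp only [Set.mem_ofPred_eq] <;> rw [abs_lt] <;> constructor <;> linarith⟩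
    have h3 := hW s t ht
    rw [hw, zero_mul] at h3
    have h4 : w₂ t = 0 := by simpa [hs, hs'] using h3.symm
    have h5 := hW s' t ht'
    rw [h4, mul_zero] at h5
    simpa [h1, h2] using h5
  have hall : ∀ n : ℕ, ∀ s, |s| < n * (δ / 2) → w₁ s = 0 := by
    intro n
    induction n with
    | zero =>
      intro s hs
      simp only [Nat.cast_zero, zero_mul] at hs
      exact absurd hs (not_lt.2 (abs_nonneg s))
    | succ n ih =>
      intro s hs
      push_cast at hs
      -- The first step starts at the point `0` itself, where the initial values make the Wronskian
      -- vanish; the induction hypothesis for `n = 0` covers no point at all.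
      rcases Nat.eq_zero_or_pos n with rfl | hn
      · refine hstep 0 s ?_ (by rwa [h0]) ?_
        · simp only [Nat.cast_zero] at hs
          rw [zero_sub, abs_neg]; linarith
        · simp only [hw₁, h0, hd0]; ring
      · have hn' : (1 : ℝ) ≤ n := by exact_mod_cast hn
        -- The point `s * n / (n + 1)` lies in the interval already covered and within `δ / 2` of
        -- `s`; a nearby `x` also avoids the zeros of `e₁`.
        obtain ⟨x, ⟨hx1, hx2⟩, hx3⟩ := exists_mem_open_of_eventually_nhdsNE ie₁
          ((hopen 0 (n * (δ / 2))).inter (isOpen_lt (f := fun x => |x - s|) (by fun_prop)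
            (continuous_const (y := δ)))) ⟨s * (n / (n + 1)), by
            constructor <;> simp only [Set.mem_ofPred_eq]
            · rw [zero_add, abs_mul, abs_of_nonneg (show (0 : ℝ) ≤ n / (n + 1) by positivity)]
              calc |s| * (n / (n + 1)) < ((n + 1) * (δ / 2)) * (n / (n + 1)) := by
                    gcongr
                _ = n * (δ / 2) := by field_simp
            · rw [show s * (n / (n + 1)) - s = -(s / (n + 1)) by field_simp; ring, abs_neg,
                abs_div, abs_of_pos (show (0 : ℝ) < n + 1 by positivity),
                div_lt_iff₀ (by positivity)]
              nlinarith⟩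
        exact hstep x s hx2 hx3 (ih x (by simpa using hx1))
  refine eq_of_wronskian_eq_zero he₁ hE₁ hzero iE₁ sE₁ (fun s => ?_) h0 h0'
  obtain ⟨n, hn⟩ := exists_nat_gt (|s| / (δ / 2))
  have := hall n s ((div_lt_iff₀ (by positivity)).1 hn)
  exact sub_eq_zero.1 this

-- Uniqueness of the CES form.

/-- A linear relation between two logistic curves is trivial up to reflection. -/
theorem sigmoid_relation {B B' a a' d d' c x₀ : ℝ} (hB : B ≠ 0)
    (ha : a ≠ 0) (ha' : a' ≠ 0)
    (h : ∀ᶠ x in 𝓝 x₀, B * Real.sigmoid (a * x + d) - B' * Real.sigmoid (a' * x + d') = c) :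
    (c = 0 ∧ B' = B ∧ a' = a ∧ d' = d) ∨ (c = B ∧ B' = -B ∧ a' = -a ∧ d' = -d) := by
  -- Analyticity extends the local relation to the whole line, so limits at both infinities can be
  -- compared.
  have hall : ∀ x, B * Real.sigmoid (a * x + d) - B' * Real.sigmoid (a' * x + d') = c := by
    have han : AnalyticOnNhd ℝ
        (fun x => B * Real.sigmoid (a * x + d) - B' * Real.sigmoid (a' * x + d')) Set.univ := by
      intro x _
      have h1 : ∀ p q : ℝ, AnalyticAt ℝ (fun x : ℝ => Real.sigmoid (p * x + q)) x := fun p q =>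
        AnalyticAt.sigmoid' (by fun_prop)
      exact (analyticAt_const.mul (h1 _ _)).sub (analyticAt_const.mul (h1 _ _))
    intro x
    exact han.eqOn_of_preconnected_of_eventuallyEq (g := fun _ => c)
      (fun _ _ => analyticAt_const) isPreconnected_univ (Set.mem_univ x₀) h (Set.mem_univ x)
  have lim : ∀ {p q : ℝ}, 0 < p → Tendsto (fun x : ℝ => Real.sigmoid (p * x + q)) atTop (𝓝 1) ∧
      Tendsto (fun x : ℝ => Real.sigmoid (p * x + q)) atBot (𝓝 0) := fun {p q} hp =>
    ⟨Real.tendsto_sigmoid_atTop.comp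
      (tendsto_atTop_add_const_right _ _ (tendsto_id.const_mul_atTop hp)),
     Real.tendsto_sigmoid_atBot.comp
      (tendsto_atBot_add_const_right _ _ (tendsto_id.const_mul_atBot hp))⟩
  have lim' : ∀ {p q : ℝ}, p < 0 → Tendsto (fun x : ℝ => Real.sigmoid (p * x + q)) atTop (𝓝 0) ∧
      Tendsto (fun x : ℝ => Real.sigmoid (p * x + q)) atBot (𝓝 1) := fun {p q} hp =>
    ⟨Real.tendsto_sigmoid_atBot.comp
      (tendsto_atBot_add_const_right _ _ (tendsto_id.const_mul_atTop_of_neg hp)),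
     Real.tendsto_sigmoid_atTop.comp
      (tendsto_atTop_add_const_right _ _ (tendsto_id.const_mul_atBot_of_neg hp))⟩
  have uniq : ∀ {l : Filter ℝ} [l.NeBot] {u u' : ℝ},
      Tendsto (fun x : ℝ => Real.sigmoid (a * x + d)) l (𝓝 u) →
      Tendsto (fun x : ℝ => Real.sigmoid (a' * x + d')) l (𝓝 u') → B * u - B' * u' = c := by
    intro l _ u u' h1 h2
    refine tendsto_nhds_unique ((h1.const_mul B).sub (h2.const_mul B')) ?_
    simp only [hall]
    exact tendsto_const_nhds
  have same : c = 0 → B = B' → (c = 0 ∧ B' = B ∧ a' = a ∧ d' = d) := by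
    intro h1 h2
    have key : ∀ x, a * x + d = a' * x + d' := fun x => by
      have := hall x
      rw [h1, ← h2, ← mul_sub] at this
      exact Real.sigmoid_injective (sub_eq_zero.1 ((mul_eq_zero.1 this).resolve_left hB))
    have k0 := key 0
    have k1 := key 1
    exact ⟨h1, h2.symm, by linarith, by linarith⟩
  have opp : c = B → B' = -B → (c = B ∧ B' = -B ∧ a' = -a ∧ d' = -d) := by
    intro h1 h2
    have key : ∀ x, -(a * x + d) = a' * x + d' := fun x => by
      have := hall x
      refine Real.sigmoid_injective ?_
      rw [Real.sigmoid_neg]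
      refine mul_left_cancel₀ hB ?_
      rw [h1, h2] at this
      linarith
    have k0 := key 0
    have k1 := key 1
    exact ⟨h1, h2, by linarith, by linarith⟩
  -- Slopes of equal sign give `c = 0` and `B' = B`; slopes of opposite sign give `c = B` and `B' =
  -- -B`.
  rcases lt_or_gt_of_ne ha with h1 | h1 <;> rcases lt_or_gt_of_ne ha' with h2 | h2
  · have e1 := uniq (lim' h1).1 (lim' h2).1
    have e2 := uniq (lim' h1).2 (lim' h2).2
    exact Or.inl (same (by linarith) (by linarith))
  · have e1 := uniq (lim' h1).1 (lim h2).1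
    have e2 := uniq (lim' h1).2 (lim h2).2
    exact Or.inr (opp (by linarith) (by linarith))
  · have e1 := uniq (lim h1).1 (lim' h2).1
    have e2 := uniq (lim h1).2 (lim' h2).2
    exact Or.inr (opp (by linarith) (by linarith))
  · have e1 := uniq (lim h1).1 (lim h2).1
    have e2 := uniq (lim h1).2 (lim h2).2
    exact Or.inl (same (by linarith) (by linarith))

/-- This turns the derivative of a log CES function in log skill into a logistic curve, to which
`sigmoid_relation` applies. -/
theorem hasDerivAt_log_one_add_exp (u : ℝ) :
    HasDerivAt (fun u => Real.log (1 + Real.exp u)) (Real.sigmoid u) u := by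
  have := ((Real.hasDerivAt_exp u).const_add 1).log (by positivity)
  convert this using 1
  rw [Real.sigmoid_def, Real.exp_neg]
  field_simp
  ring

/-- The source of the reflected solution: reversing the signs of both CES exponents, with a matching
change of weights, alters the log of the aggregate only by an affine term. -/
theorem log_one_add_exp_neg (u : ℝ) :
    Real.log (1 + Real.exp (-u)) = Real.log (1 + Real.exp u) - u := by
  have : 1 + Real.exp u = (1 + Real.exp (-u)) * Real.exp u := by
    rw [add_mul, one_mul, ← Real.exp_add]; simp [add_comm]
  rw [this, Real.log_mul (by positivity) (by positivity), Real.log_exp]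
  ring

/-- Factoring out the second term isolates the nonlinearity in one function of the difference of the
exponents. -/
theorem log_ces_eq {g₁ g₂ : ℝ} (h₁ : 0 < g₁) (h₂ : 0 < g₂) (p q : ℝ) :
    Real.log (g₁ * Real.exp p + g₂ * Real.exp q) =
      Real.log g₂ + q + Real.log (1 + Real.exp (p - q + (Real.log g₁ - Real.log g₂))) := by
  have : g₁ * Real.exp p + g₂ * Real.exp q =
      g₂ * Real.exp q * (1 + Real.exp (p - q + (Real.log g₁ - Real.log g₂))) := by
    rw [Real.exp_add, Real.exp_sub, Real.exp_sub, Real.exp_log h₁, Real.exp_log h₂]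
    field_simp
    ring
  rw [this, Real.log_mul (by positivity) (by positivity), Real.log_mul h₂.ne' (by positivity),
    Real.log_exp]

/-- If two log CES functions differ near a point by a multiple of the residual of an affine
investment equation, then they coincide, unless the investment equation is knife-edge. -/
theorem ces_unique {A A' a a' b b' g₁ g₁' g₂ g₂' k β₀ β₁ β₂ : ℝ} {w : ℝ × ℝ × ℝ}
    (hA : A ≠ 0) (ha : a ≠ 0) (ha' : a' ≠ 0) (hb : b ≠ 0)
    (hg₁ : 0 < g₁) (hg₁' : 0 < g₁') (hg₂ : 0 < g₂) (hg₂' : 0 < g₂')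
    (hβ : β₂ = 0 → b * β₁ ≠ -a)
    (h : ∀ᶠ x in 𝓝 w,
      A * Real.log (g₁ * Real.exp (a * x.1) + g₂ * Real.exp (b * x.2.1)) -
        A' * Real.log (g₁' * Real.exp (a' * x.1) + g₂' * Real.exp (b' * x.2.1)) =
      k * (x.2.1 - β₀ - β₁ * x.1 - β₂ * x.2.2)) :
    A' = A ∧ a' = a ∧ b' = b ∧ g₁' = g₁ ∧ g₂' = g₂ := by
  obtain ⟨x₀, z₀, l₀⟩ := w
  set γ := Real.log g₁ - Real.log g₂ with hγ
  set γ' := Real.log g₁' - Real.log g₂' with hγ'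
  set F : ℝ → ℝ → ℝ := fun x z =>
    A * (Real.log g₂ + b * z + Real.log (1 + Real.exp (a * x - b * z + γ))) -
    A' * (Real.log g₂' + b' * z + Real.log (1 + Real.exp (a' * x - b' * z + γ'))) with hF
  have hFe : ∀ᶠ x in 𝓝 x₀, ∀ᶠ z in 𝓝 z₀, ∀ᶠ l in 𝓝 l₀,
      F x z = k * (z - β₀ - β₁ * x - β₂ * l) := by
    rw [nhds_prod_eq] at h
    have h1 := h.curry
    filter_upwards [h1] with x hx
    rw [nhds_prod_eq] at hx
    filter_upwards [hx.curry] with z hz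
    filter_upwards [hz] with l hl
    rw [← hl]
    simp only [hF]
    rw [log_ces_eq hg₁ hg₂, log_ces_eq hg₁' hg₂']
  have ex : ∀ {p : ℝ → Prop} {y : ℝ}, (∀ᶠ l in 𝓝 y, p l) → ∃ l, l ≠ y ∧ p l ∧ p y := by
    intro p y hp
    have h1 : ∀ᶠ l in 𝓝[≠] y, p l := nhdsWithin_le_nhds hp
    obtain ⟨l, hl, hly⟩ := (h1.and self_mem_nhdsWithin).exists
    exact ⟨l, hly, hl, hp.self_of_nhds⟩
  -- Only the residual depends on log income.
  have hk2 : k * β₂ = 0 := by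
    obtain ⟨l, hl, h1, h2⟩ := ex hFe.self_of_nhds.self_of_nhds
    have h3 : k * β₂ * (l - l₀) = 0 := by linear_combination h1 - h2
    exact (mul_eq_zero.1 h3).resolve_right (sub_ne_zero.2 hl)
  have hFe' : ∀ᶠ z in 𝓝 z₀, ∀ᶠ x in 𝓝 x₀, F x z = k * (z - β₀ - β₁ * x) := by
    rw [nhds_prod_eq] at h
    have h2 : ∀ᶠ y : ℝ × ℝ in 𝓝 (x₀, z₀), F y.1 y.2 = k * (y.2 - β₀ - β₁ * y.1) := by
      have hc : Tendsto (fun y : ℝ × ℝ => (y.1, y.2, l₀)) (𝓝 (x₀, z₀)) (𝓝 x₀ ×ˢ 𝓝 (z₀, l₀)) := by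
        rw [← nhds_prod_eq]
        exact (by fun_prop : Continuous fun y : ℝ × ℝ => (y.1, y.2, l₀)).tendsto (x₀, z₀)
      filter_upwards [hc.eventually h] with y hy
      have : F y.1 y.2 = k * (y.2 - β₀ - β₁ * y.1 - β₂ * l₀) := by
        rw [← hy]
        simp only [hF]
        rw [log_ces_eq hg₁ hg₂, log_ces_eq hg₁' hg₂']
      rw [this]
      linear_combination -l₀ * hk2
    have hs : Tendsto (fun y : ℝ × ℝ => (y.2, y.1)) (𝓝 (z₀, x₀)) (𝓝 (x₀, z₀)) :=
      continuous_swap.tendsto (z₀, x₀)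
    have h3 := hs.eventually h2
    rw [nhds_prod_eq] at h3
    exact h3.curry
  -- For fixed log investment, the derivative in log skill is a difference of logistic curves that
  -- equals the constant `-(k * β₁)`.
  have hrel : ∀ᶠ z in 𝓝 z₀,
      (-(k * β₁) = 0 ∧ A' * a' = A * a ∧ a' = a ∧ -(b' * z) + γ' = -(b * z) + γ) ∨
      (-(k * β₁) = A * a ∧ A' * a' = -(A * a) ∧ a' = -a ∧
        -(b' * z) + γ' = -(-(b * z) + γ)) := by
    filter_upwards [hFe'] with z hz
    refine sigmoid_relation (x₀ := x₀) (mul_ne_zero hA ha) ha ha' ?_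
    filter_upwards [hz.eventually_nhds] with x hx
    have hlog : ∀ p q : ℝ, HasDerivAt (fun x => Real.log (1 + Real.exp (p * x + q)))
        (Real.sigmoid (p * x + q) * p) x := fun p q =>
      HasDerivAt.comp x (h := fun x => p * x + q) (hasDerivAt_log_one_add_exp (p * x + q))
        (by simpa using ((hasDerivAt_id x).const_mul p).add_const q)
    have d1 : HasDerivAt (fun x => F x z)
        (A * (Real.sigmoid (a * x + (-(b * z) + γ)) * a) -
          A' * (Real.sigmoid (a' * x + (-(b' * z) + γ')) * a')) x := by
      have := (((hlog a (-(b * z) + γ)).const_add (Real.log g₂ + b * z)).const_mul A).sub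
        (((hlog a' (-(b' * z) + γ')).const_add (Real.log g₂' + b' * z)).const_mul A')
      refine this.congr_of_eventuallyEq (Eventually.of_forall fun x => ?_)
      simp only [hF, Pi.sub_apply]
      ring_nf
    have d2 : HasDerivAt (fun x => F x z) (-(k * β₁)) x := by
      have : HasDerivAt (fun x => k * (z - β₀ - β₁ * x)) (k * (-(β₁ * 1))) x :=
        (((hasDerivAt_id x).const_mul β₁).const_sub (z - β₀)).const_mul k
      rw [mul_one, mul_neg] at this
      exact this.congr_of_eventuallyEq hx
    rw [← d1.unique d2]
    ring
  -- Two investment levels suffice. The same alternative holds at both, since `a' = a` and `a' = -a`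
  -- exclude each other for `a ≠ 0`; comparing the shifts then gives `b'`.
  obtain ⟨z, hz, ⟨h1, h2⟩, h3, h4⟩ := ex (hrel.and hFe')
  replace h2 := h2.self_of_nhds
  replace h4 := h4.self_of_nhds
  have hz' := sub_ne_zero.2 hz
  rcases h1 with ⟨c1, c2, c3, c4⟩ | ⟨c1, c2, c3, c4⟩
  · have hAA : A' = A := by rw [c3] at c2; exact mul_right_cancel₀ ha c2
    have e3 : -(b' * z₀) + γ' = -(b * z₀) + γ := by
      rcases h3 with ⟨_, _, _, h⟩ | ⟨_, _, h, _⟩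
      · exact h
      · exact absurd (show a = 0 by linarith) ha
    have hbb : b' = b := by
      have : (b' - b) * (z - z₀) = 0 := by linear_combination e3 - c4
      exact sub_eq_zero.1 ((mul_eq_zero.1 this).resolve_right hz')
    have hγγ : γ' = γ := by rw [hbb] at e3; linarith
    simp only [hF, hAA, c3, hbb, hγγ] at h2 h4
    have hk : k = 0 := by
      have : k * (z - z₀) = 0 := by linear_combination h4 - h2
      exact (mul_eq_zero.1 this).resolve_right hz'
    have hl : Real.log g₂' = Real.log g₂ := by
      refine mul_left_cancel₀ hA ?_
      rw [hk] at h2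
      linarith
    have hl₁ : Real.log g₁' = Real.log g₁ := by
      simp only [hγ, hγ'] at hγγ; linarith
    exact ⟨hAA, c3, hbb, Real.log_injOn_pos hg₁' hg₁ hl₁, Real.log_injOn_pos hg₂' hg₂ hl⟩
  -- In the reflected case the nonlinear terms cancel and the difference is affine with slopes `A *
  -- a` and `A * b`. Matching it with the residual gives `k = A * b`, hence `β₂ = 0` and `b * β₁ =
  -- -a`.
  · exfalso
    have hAA : A' = A := by
      rw [c3] at c2
      refine mul_right_cancel₀ ha ?_
      linarith
    have e3 : -(b' * z₀) + γ' = -(-(b * z₀) + γ) := by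
      rcases h3 with ⟨_, _, h, _⟩ | ⟨_, _, _, h⟩
      · exact absurd (show a = 0 by linarith) ha
      · exact h
    have hbb : b' = -b := by
      have : (b' + b) * (z - z₀) = 0 := by linear_combination e3 - c4
      have := (mul_eq_zero.1 this).resolve_right hz'
      linarith
    have hγγ : γ' = -γ := by rw [hbb] at e3; linarith
    have r : ∀ z, -a * x₀ - -b * z + -γ = -(a * x₀ - b * z + γ) := fun z => by ring
    simp only [hF, hAA, c3, hbb, hγγ, r, log_one_add_exp_neg] at h2 h4
    have hk : k = A * b := by
      have : (A * b - k) * (z - z₀) = 0 := by linear_combination h2 - h4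
      have := (mul_eq_zero.1 this).resolve_right hz'
      linarith
    have hβ₂ : β₂ = 0 := (mul_eq_zero.1 hk2).resolve_left (by rw [hk]; exact mul_ne_zero hA hb)
    refine hβ hβ₂ (mul_left_cancel₀ hA ?_)
    rw [hk] at c1
    linarith

-- Conditional independence as a product of conditional distributions.

section Conditional

variable {Ω 𝓨 : Type*} [MeasurableSpace Ω] [StandardBorelSpace Ω] [MeasurableSpace 𝓨]
  {μ : Measure Ω} [IsProbabilityMeasure μ] {Y : Ω → 𝓨}

/-- The conditional distribution of a conditionally independent pair is a product. -/
theorem condDistrib_prodMk_eq_prod {β γ : Type*} [MeasurableSpace β] [MeasurableSpace γ]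
    [StandardBorelSpace β] [Nonempty β] [StandardBorelSpace γ] [Nonempty γ]
    {f : Ω → β} {g : Ω → γ} (hf : Measurable f) (hg : Measurable g) (hY : Measurable Y)
    (h : CondIndepFun (MeasurableSpace.comap Y inferInstance) hY.comap_le f g μ) :
    ∀ᵐ y ∂(μ.map Y), condDistrib (fun ω => (f ω, g ω)) Y μ y =
      (condDistrib f Y μ y).prod (condDistrib g Y μ y) := by
  have h1 := (condIndepFun_iff_map_prod_eq_prod_condDistrib_prod_condDistrib hf hg hY).1 h
  rw [← Measure.compProd_eq_comp_prod] at h1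
  filter_upwards [condDistrib_ae_eq_of_measure_eq_compProd Y (hf.prodMk hg).aemeasurable h1]
    with y hy
  rw [hy, Kernel.prod_apply]

/-- The conditional distribution of a conditionally independent family of real random variables
is a product. -/
theorem condDistrib_pi_eq_pi {J : Type*} [Fintype J] {e : J → Ω → ℝ}
    (he : ∀ j, Measurable (e j)) (hY : Measurable Y)
    (h : iCondIndepFun (MeasurableSpace.comap Y inferInstance) hY.comap_le e μ) :
    ∀ᵐ y ∂(μ.map Y), condDistrib (fun ω j => e j ω) Y μ y =
      Measure.pi fun j => condDistrib (e j) Y μ y := by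
  have he' : Measurable fun ω j => e j ω := measurable_pi_lambda _ he
  -- Rational corners give countably many boxes, so one null set serves for all of them; they form a
  -- π-system that determines the product measure.
  have key : ∀ q : J → ℚ, ∀ᵐ y ∂(μ.map Y),
      condDistrib (fun ω j => e j ω) Y μ y (Set.univ.pi fun j => Set.Iic (q j : ℝ)) =
        ∏ j, condDistrib (e j) Y μ y (Set.Iic (q j : ℝ)) := by
    intro q
    have hS : MeasurableSet (Set.univ.pi fun j => Set.Iic (q j : ℝ)) :=
      MeasurableSet.univ_pi fun j => measurableSet_Iic
    rw [ae_map_iff hY.aemeasurable (measurableSet_eq_fun (Kernel.measurable_coe _ hS)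
      (Finset.measurable_prod _ fun j _ => Kernel.measurable_coe _ measurableSet_Iic))]
    have h1 := h.meas_iInter (s := fun j => e j ⁻¹' Set.Iic (q j : ℝ))
      (fun j => ⟨_, measurableSet_Iic, rfl⟩)
    have h2 := ae_of_ae_trim hY.comap_le h1
    have h3 := condDistrib_apply_ae_eq_condExpKernel_map (μ := μ) he' hY hS
    have h4 : ∀ j, _ := fun j => condDistrib_apply_ae_eq_condExpKernel_map (μ := μ) (he j) hY
      (measurableSet_Iic (a := (q j : ℝ)))
    filter_upwards [h2, h3, ae_all_iff.2 h4] with ω h2 h3 h4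
    have h5 : (fun ω j => e j ω) ⁻¹' (Set.univ.pi fun j => Set.Iic (q j : ℝ)) =
        ⋂ j, e j ⁻¹' Set.Iic (q j : ℝ) := by
      ext ω; simp [Pi.le_def]
    simp only [h3, h4]
    rw [Kernel.map_apply' _ he' _ hS, h5, h2]
    refine Finset.prod_congr rfl fun j _ => ?_
    rw [Kernel.map_apply' _ (he j) _ measurableSet_Iic]
  filter_upwards [ae_all_iff.2 key] with y hy
  symm
  refine Measure.pi_eq_generateFrom (C := fun _ => ⋃ q : ℚ, {Set.Iic (q : ℝ)}) (fun _ => ?_)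
    (fun _ => Real.isPiSystem_Iic_rat) (fun j => ?_) ?_
  · rw [← Real.borel_eq_generateFrom_Iic_rat]
    exact (BorelSpace.measurable_eq (α := ℝ)).symm
  · exact
    { set := fun n => Set.Iic (n : ℝ)
      set_mem := fun n => Set.mem_iUnion.2 ⟨n, by simp⟩
      finite := fun n => measure_lt_top _ _
      spanning := Set.eq_univ_of_forall fun x => by
        obtain ⟨n, hn⟩ := exists_nat_ge x
        exact Set.mem_iUnion.2 ⟨n, hn⟩ }
  · intro s hs
    have : ∀ j, ∃ q : ℚ, s j = Set.Iic (q : ℝ) := fun j => by simpa [eq_comm] using hs j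
    choose q hq using this
    rw [show s = fun j => Set.Iic (q j : ℝ) from funext hq]
    exact hy q

end Conditional

-- Deconvolution of the measurement system.

/-- The measurement system: each latent variable has two affine measures with additive errors. -/
def measurementMap {ι : Type*} (m l : ι → Fin 2 → ℝ) (x : (ι → ℝ) × (ι × Fin 2 → ℝ)) : ι × Fin 2 → ℝ :=
  fun j => m j.1 j.2 + l j.1 j.2 * x.1 j.1 + x.2 j

theorem measurable_measurementMap {ι : Type*} (m l : ι → Fin 2 → ℝ) : Measurable (measurementMap m l) := by
  unfold measurementMap
  fun_prop

section Factor

variable {ι : Type*} [Fintype ι]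

/-- The characteristic function of a measure on a finite power of the line. -/
noncomputable def piCharFun {J : Type*} [Fintype J] (P : Measure (J → ℝ)) (s : J → ℝ) : ℂ :=
  ∫ x, Complex.exp (((∑ j, s j * x j : ℝ) : ℂ) * Complex.I) ∂P

theorem continuous_piCharFun (P : Measure (ι → ℝ)) [IsFiniteMeasure P] :
    Continuous (piCharFun P) := by
  refine continuous_of_dominated (bound := fun _ => 1) (fun s => ?_) (fun s => ?_)
    (integrable_const _) ?_
  · exact (by fun_prop : Continuous fun x : ι → ℝ =>
      Complex.exp (((∑ j, s j * x j : ℝ) : ℂ) * Complex.I)).aestronglyMeasurable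
  · exact Eventually.of_forall fun x => (Complex.norm_exp_ofReal_mul_I _).le
  · exact Eventually.of_forall fun x => by fun_prop

theorem piCharFun_zero (P : Measure (ι → ℝ)) [IsProbabilityMeasure P] : piCharFun P 0 = 1 := by
  simp [piCharFun]

/-- In coordinates every continuous linear functional is `x ↦ ∑ j, s j * x j`, so this reduces to
uniqueness for `charFunDual`. -/
theorem eq_of_piCharFun_eq {P P' : Measure (ι → ℝ)} [IsFiniteMeasure P] [IsFiniteMeasure P']
    (h : piCharFun P = piCharFun P') : P = P' := by
  classical
  refine Measure.ext_of_charFunDual (funext fun L => ?_)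
  have hL : ∀ x : ι → ℝ, L x = ∑ j, L (Pi.single j 1) * x j := by
    intro x
    conv_lhs => rw [pi_eq_sum_univ' x, map_sum]
    refine Finset.sum_congr rfl fun j _ => ?_
    rw [map_smul, smul_eq_mul, mul_comm]
  have := congrFun h fun j => L (Pi.single j 1)
  simp only [piCharFun, ← hL] at this
  simpa only [charFunDual_apply] using this

theorem piCharFun_pi {J : Type*} [Fintype J] (ν : J → Measure ℝ) [∀ j, IsProbabilityMeasure (ν j)]
    (s : J → ℝ) : piCharFun (Measure.pi ν) s = ∏ j, charFun (ν j) (s j) := by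
  simp only [charFun_apply_real]
  rw [← integral_fintype_prod_eq_prod]
  refine integral_congr_ae (Eventually.of_forall fun x => ?_)
  simp only
  rw [← Complex.exp_sum]
  push_cast
  rw [Finset.sum_mul]

/-- Independence splits off the errors. The two measures of a latent variable share it, so their
frequencies enter its argument as a sum weighted by the loadings. -/
theorem piCharFun_map_measurementMap (m l : ι → Fin 2 → ℝ) (P : Measure (ι → ℝ))
    [IsProbabilityMeasure P] (ν : ι × Fin 2 → Measure ℝ) [∀ j, IsProbabilityMeasure (ν j)]
    (s : ι × Fin 2 → ℝ) :
    piCharFun ((P.prod (Measure.pi ν)).map (measurementMap m l)) s =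
      Complex.exp (((∑ j, s j * m j.1 j.2 : ℝ) : ℂ) * Complex.I) *
        (piCharFun P (fun i => ∑ k, s (i, k) * l i k) * ∏ j, charFun (ν j) (s j)) := by
  rw [← piCharFun_pi]
  simp only [piCharFun]
  rw [integral_map (measurable_measurementMap m l).aemeasurable
    (by fun_prop : Continuous fun x : ι × Fin 2 → ℝ =>
      Complex.exp (((∑ j, s j * x j : ℝ) : ℂ) * Complex.I)).aestronglyMeasurable,
    ← integral_prod_mul, ← integral_const_mul]
  refine integral_congr_ae (Eventually.of_forall fun x => ?_)
  simp only
  rw [← Complex.exp_add, ← Complex.exp_add]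
  congr 1
  have : (∑ j, s j * measurementMap m l x j : ℝ) = (∑ j, s j * m j.1 j.2) +
      (∑ i, (∑ k, s (i, k) * l i k) * x.1 i + ∑ j, s j * x.2 j) := by
    have h1 : ∑ i, (∑ k, s (i, k) * l i k) * x.1 i =
        ∑ j : ι × Fin 2, s j * l j.1 j.2 * x.1 j.1 := by
      rw [Fintype.sum_prod_type]
      exact Finset.sum_congr rfl fun i _ => Finset.sum_mul _ _ _
    rw [h1, ← Finset.sum_add_distrib, ← Finset.sum_add_distrib]
    refine Finset.sum_congr rfl fun j _ => ?_
    simp only [measurementMap]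
    ring
  rw [this]
  push_cast
  ring

/-- The regularity conditions on the distribution of a measurement error. -/
structure ErrorLaw (ν : Measure ℝ) : Prop where
  prob : IsProbabilityMeasure ν
  integrable : Integrable id ν
  mean : ∫ x, x ∂ν = 0
  regular : CharFunRegular ν

namespace ErrorLaw

variable {ν : Measure ℝ}

theorem memLp (h : ErrorLaw ν) : MemLp id (1 : ℕ) ν := by
  rw [Nat.cast_one, memLp_one_iff_integrable]
  exact h.integrable

theorem differentiable (h : ErrorLaw ν) : Differentiable ℝ (charFun ν) := by
  have := h.prob
  exact (contDiff_charFun h.memLp).differentiable (by simp)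

/-- Mean zero provides the initial condition that makes the Wronskian vanish at the origin. -/
theorem deriv_zero (h : ErrorLaw ν) : deriv (charFun ν) 0 = 0 := by
  have := h.prob
  have h1 := iteratedDeriv_charFun_zero h.memLp
  rw [iteratedDeriv_one] at h1
  rw [h1]
  simp [h.mean]

theorem charFun_zero (h : ErrorLaw ν) : charFun ν 0 = 1 := by
  have := h.prob
  simp

theorem eventually_ne (h : ErrorLaw ν) (s : ℝ) : ∀ᶠ s' in 𝓝[≠] s, charFun ν s' ≠ 0 := by
  by_cases hs : charFun ν s = 0
  · exact (h.regular s hs).1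
  · exact nhdsWithin_le_nhds (h.differentiable.continuous.continuousAt.eventually_ne hs)

end ErrorLaw

/-- The distribution of the first errors is determined by the distribution of the measures. -/
theorem charFun_error_eq {m l : ι → Fin 2 → ℝ} (hl0 : ∀ i, l i 0 = 1) (hl1 : ∀ i, l i 1 ≠ 0)
    {P P' : Measure (ι → ℝ)} [IsProbabilityMeasure P] [IsProbabilityMeasure P']
    {ν ν' : ι × Fin 2 → Measure ℝ} (hν : ∀ j, ErrorLaw (ν j)) (hν' : ∀ j, ErrorLaw (ν' j))
    (h : (P.prod (Measure.pi ν)).map (measurementMap m l) =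
      (P'.prod (Measure.pi ν')).map (measurementMap m l)) (i : ι) :
    charFun (ν (i, 0)) = charFun (ν' (i, 0)) := by
  classical
  have := fun j => (hν j).prob
  have := fun j => (hν' j).prob
  set c := l i 1
  have hc : c ≠ 0 := hl1 i
  have scale : ∀ {e : ℝ → ℂ}, (∀ s, ∀ᶠ s' in 𝓝[≠] s, e s' ≠ 0) →
      ∀ s, ∀ᶠ s' in 𝓝[≠] s, e (s' / c) ≠ 0 := by
    intro e he s
    have : Tendsto (fun s' => s' / c) (𝓝[≠] s) (𝓝[≠] (s / c)) := by
      refine tendsto_nhdsWithin_of_tendsto_nhds_of_eventually_within _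
        ((continuous_id.div_const c).tendsto s |>.mono_left nhdsWithin_le_nhds) ?_
      filter_upwards [self_mem_nhdsWithin] with s' hs'
      exact fun h => hs' (by simpa [div_left_inj' hc] using h)
    exact this.eventually (he (s / c))
  have dscale : ∀ {e : ℝ → ℂ}, Differentiable ℝ e → Differentiable ℝ fun s => e (s / c) :=
    fun he => he.comp (differentiable_id.div_const c)
  have contAt : ∀ (P : Measure (ι → ℝ)) [IsProbabilityMeasure P],
      ContinuousAt (fun x : ℝ => piCharFun P (Pi.single i x)) 0 := fun P _ =>
    ((continuous_piCharFun P).comp (continuous_single i)).continuousAt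
  have val0 : ∀ (P : Measure (ι → ℝ)) [IsProbabilityMeasure P],
      (fun x : ℝ => piCharFun P (Pi.single i x)) 0 ≠ 0 := fun P _ => by
    simp [piCharFun_zero]
  refine eq_of_add_mul_mul_eq (contAt P) (contAt P') (val0 P) (val0 P')
    (hν _).differentiable (hν' _).differentiable
    (dscale (hν (i, 1)).differentiable) (dscale (hν' (i, 1)).differentiable)
    (by rw [(hν _).charFun_zero, (hν' _).charFun_zero])
    (by rw [(hν' _).charFun_zero]; exact one_ne_zero)
    (by rw [(hν _).deriv_zero, (hν' _).deriv_zero])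
    (hν _).eventually_ne (hν' _).eventually_ne
    (scale (hν (i, 1)).eventually_ne) (scale (hν' (i, 1)).eventually_ne)
    (fun s hs => ((hν' _).regular s hs).2) fun s t => ?_
  -- Only the two measures of `i` get a nonzero frequency. Dividing `t` by the second loading `c`
  -- makes the latent frequency exactly `s + t`.
  set u : ι × Fin 2 → ℝ := fun j => if j = (i, 0) then s else if j = (i, 1) then t / c else 0 with hu
  have h1 := congrArg (fun R => piCharFun R u) h
  simp only [piCharFun_map_measurementMap] at h1
  have h2 := mul_left_cancel₀ (Complex.exp_ne_zero _) h1
  have hlat : (fun i' => ∑ k, u (i', k) * l i' k) = Pi.single i (s + t) := by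
    funext i'
    rw [Fin.sum_univ_two]
    by_cases hi : i' = i
    · subst hi
      simp only [hu, hl0, Pi.single_eq_same]
      simp only [Prod.mk.injEq, true_and, if_true, if_false, one_ne_zero, mul_one]
      change s + t / c * c = s + t
      rw [div_mul_cancel₀ t hc]
    · simp [hu, hi]
  have hprod : ∀ (ν : ι × Fin 2 → Measure ℝ), (∀ j, ErrorLaw (ν j)) →
      ∏ j, charFun (ν j) (u j) = charFun (ν (i, 0)) s * charFun (ν (i, 1)) (t / c) := by
    intro ν hν
    rw [Finset.prod_eq_mul (i, 0) (i, 1) (by simp)]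
    · simp [hu]
    · intro j _ hj
      simp [hu, hj.1, hj.2, (hν j).charFun_zero]
    · simp
    · simp
  rwa [hlat, hprod ν hν, hprod ν' hν'] at h2

/-- The distribution of the latent variables is determined by the distribution
of their measures. -/
theorem latent_law_eq {m l : ι → Fin 2 → ℝ} (hl0 : ∀ i, l i 0 = 1) (hl1 : ∀ i, l i 1 ≠ 0)
    {P P' : Measure (ι → ℝ)} [IsProbabilityMeasure P] [IsProbabilityMeasure P']
    {ν ν' : ι × Fin 2 → Measure ℝ} (hν : ∀ j, ErrorLaw (ν j)) (hν' : ∀ j, ErrorLaw (ν' j))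
    (h : (P.prod (Measure.pi ν)).map (measurementMap m l) =
      (P'.prod (Measure.pi ν')).map (measurementMap m l)) : P = P' := by
  classical
  have := fun j => (hν j).prob
  have := fun j => (hν' j).prob
  have herr := charFun_error_eq hl0 hl1 hν hν' h
  -- Off the zeros of the first errors' characteristic functions these can be cancelled. That set is
  -- a product of dense sets, and continuity covers the rest.
  refine eq_of_piCharFun_eq (Continuous.ext_on (s := Set.univ.pi fun i =>
    {x : ℝ | charFun (ν (i, 0)) x ≠ 0}) (dense_pi _ fun i _ => ?_) (continuous_piCharFun P)
    (continuous_piCharFun P') fun s hs => ?_)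
  · exact dense_iff_inter_open.2 fun U hU hne =>
      exists_mem_open_of_eventually_nhdsNE (hν (i, 0)).eventually_ne hU hne
  -- First measures alone have unit loadings, so the latent frequency is `s` itself and the second
  -- errors contribute factors `1`.
  · set u : ι × Fin 2 → ℝ := fun j => if j.2 = 0 then s j.1 else 0 with hu
    have h1 := congrArg (fun R => piCharFun R u) h
    simp only [piCharFun_map_measurementMap] at h1
    have h2 := mul_left_cancel₀ (Complex.exp_ne_zero _) h1
    have hlat : (fun i => ∑ k, u (i, k) * l i k) = s := by
      funext i
      simp [hu, hl0]
    have hprod : ∀ (ν : ι × Fin 2 → Measure ℝ), (∀ j, ErrorLaw (ν j)) →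
        ∏ j, charFun (ν j) (u j) = ∏ i, charFun (ν (i, 0)) (s i) := by
      intro ν hν
      rw [Fintype.prod_prod_type]
      refine Finset.prod_congr rfl fun i _ => ?_
      simp [Fin.prod_univ_two, hu, (hν (i, 1)).charFun_zero]
    rw [hlat, hprod ν hν, hprod ν' hν'] at h2
    simp only [herr] at h2 hs
    exact mul_right_cancel₀ (Finset.prod_ne_zero_iff.2 fun i _ => hs i (Set.mem_univ i)) h2

end Factor

-- The law of the normalised latent variables.

/-- Index set of the latent variables: skills and investments. -/
abbrev LatIdx (T : ℕ) : Type := Fin (T + 1) ⊕ Fin T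

/-- The measurement errors among all errors. -/
def measErrIdx {T : ℕ} : LatIdx T × Fin 2 → ErrIdx T
  | (.inl t, m) => .inl (t, m)
  | (.inr t, m) => .inr (.inl (t, m))

theorem measErrIdx_injective {T : ℕ} : Function.Injective (measErrIdx (T := T)) := by
  rintro ⟨t | t, m⟩ ⟨s | s, n⟩ h <;> simp_all [measErrIdx]

namespace CESTransformed

variable {T : ℕ}

/-- Intercepts of the measures relative to the first measures. -/
def intercept (τ : CESTransformed T) : LatIdx T → Fin 2 → ℝ := Sum.elim τ.muθ τ.muI

/-- Loadings of the measures relative to the first measures. -/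
def loading (τ : CESTransformed T) : LatIdx T → Fin 2 → ℝ := Sum.elim τ.lamθ τ.lamI

end CESTransformed

/-- The skill and investment measures in the data. -/
def SkillData.measures {T : ℕ} (d : SkillData T) : LatIdx T × Fin 2 → ℝ
  | (.inl t, m) => d.1 t m
  | (.inr t, m) => d.2.1 t m

theorem SkillData.measurable_measures {T : ℕ} : Measurable (SkillData.measures (T := T)) := by
  refine measurable_pi_lambda _ fun j => ?_
  rcases j with ⟨t | t, m⟩ <;> simp only [SkillData.measures] <;> fun_prop

namespace SkillVars

variable {T : ℕ} {Ω : Type} [MeasurableSpace Ω]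

theorem measurable_logθ (v : SkillVars T Ω) (t : Fin (T + 1)) : Measurable (v.logθ t) :=
  (v.measurable_θ t).log

theorem measurable_logI (v : SkillVars T Ω) (t : Fin T) : Measurable (v.logI t) :=
  (v.measurable_inv t).log

theorem measurable_err (v : SkillVars T Ω) : ∀ i, Measurable (v.err i)
  | .inl (t, m) => v.measurable_εθ t m
  | .inr (.inl (t, m)) => v.measurable_εI t m
  | .inr (.inr _) => v.measurable_ηQ

/-- The latent variables in the units and with the location of their first measures. -/
noncomputable def normLatent (v : SkillVars T Ω) (p : CESParams T) (ω : Ω) : LatIdx T → ℝ :=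
  Sum.elim (fun t => p.muθ t 0 + p.lamθ t 0 * v.logθ t ω)
    (fun t => p.muI t 0 + p.lamI t 0 * v.logI t ω)

theorem measurable_normLatent (v : SkillVars T Ω) (p : CESParams T) :
    Measurable (v.normLatent p) := by
  refine measurable_pi_lambda _ fun j => ?_
  rcases j with t | t
  · exact ((v.measurable_logθ t).const_mul _).const_add _
  · exact ((v.measurable_logI t).const_mul _).const_add _

theorem measurable_observed (v : SkillVars T Ω) (p : CESParams T) :
    Measurable (v.observed p) := by
  have h1 := v.measurable_logθ
  have h2 := v.measurable_logI
  have h3 := v.measurable_εθ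
  have h4 := v.measurable_εI
  have h5 := v.measurable_ηQ
  have h6 := v.measurable_Y
  unfold observed
  fun_prop

/-- Solving the first measure for the latent variable and substituting it into the others replaces
the primitive coefficients by the relative ones, which can be matched across structures. -/
theorem measures_observed (v : SkillVars T Ω) {p : CESParams T} (hp : p.Admissible) (ω : Ω) :
    SkillData.measures (v.observed p ω) =
      measurementMap p.transformed.intercept p.transformed.loading
        (v.normLatent p ω, fun j => v.err (measErrIdx j) ω) := by
  funext ⟨i, m⟩
  rcases i with t | t
  · have := hp.lamθ_ne t 0
    simp only [SkillData.measures, observed, measurementMap, CESTransformed.intercept,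
      CESTransformed.loading, normLatent, CESParams.transformed, Sum.elim_inl, measErrIdx, err]
    field_simp
    ring
  · have := hp.lamI_ne t 0
    simp only [SkillData.measures, observed, measurementMap, CESTransformed.intercept,
      CESTransformed.loading, normLatent, CESParams.transformed, Sum.elim_inr, measErrIdx, err]
    field_simp
    ring

end SkillVars

theorem CESParams.Admissible.loading_zero {T : ℕ} {p : CESParams T} (hp : p.Admissible)
    (i : LatIdx T) : p.transformed.loading i 0 = 1 := by
  rcases i with t | t
  · exact div_self (hp.lamθ_ne t 0)
  · exact div_self (hp.lamI_ne t 0)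

theorem CESParams.Admissible.loading_one_ne {T : ℕ} {p : CESParams T} (hp : p.Admissible)
    (i : LatIdx T) : p.transformed.loading i 1 ≠ 0 := by
  rcases i with t | t
  · exact div_ne_zero (hp.lamθ_ne t 1) (hp.lamθ_ne t 0)
  · exact div_ne_zero (hp.lamI_ne t 1) (hp.lamI_ne t 0)

section Model

variable {T : ℕ} {Ω : Type} [MeasurableSpace Ω] [StandardBorelSpace Ω] {μ : Measure Ω}
  [IsProbabilityMeasure μ] {v : SkillVars T Ω}

/-- Conditionally on income, each error satisfies the regularity conditions. -/
theorem BaselineAssumption.ae_errorLaw (hA : BaselineAssumption v μ) (i : ErrIdx T) :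
    ∀ᵐ y ∂(μ.map v.income), ErrorLaw (condDistrib (v.err i) v.income μ y) := by
  have hm := v.measurable_err i
  have hint : Integrable (v.err i) μ := (hA.memLp_err i).integrable one_le_two
  have h1 : ∀ᵐ y ∂(μ.map v.income), Integrable id (condDistrib (v.err i) v.income μ y) := by
    have hf : AEStronglyMeasurable (fun x : (Fin T → ℝ) × ℝ => x.2)
      (μ.map fun ω => (v.income ω, v.err i ω)) := measurable_snd.aestronglyMeasurable
    refine ((hf.ae_integrable_condDistrib_map_iff hm.aemeasurable).2 ?_).1
    rw [integrable_map_measure hf (v.measurable_income.prodMk hm).aemeasurable]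
    exact hint
  have h2 : ∀ᵐ y ∂(μ.map v.income), ∫ x, x ∂(condDistrib (v.err i) v.income μ y) = 0 := by
    have hmeas : StronglyMeasurable fun y => ∫ x, x ∂(condDistrib (v.err i) v.income μ y) :=
      StronglyMeasurable.integral_condDistrib (f := fun x : (Fin T → ℝ) × ℝ => x.2)
        measurable_snd.stronglyMeasurable
    rw [ae_map_iff v.measurable_income.aemeasurable
      (measurableSet_eq_fun hmeas.measurable measurable_const)]
    filter_upwards [hA.err_mean i,
      condExp_ae_eq_integral_condDistrib' v.measurable_income hint] with ω h3 h4
    rw [← h4, h3, Pi.zero_apply]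
  filter_upwards [h1, h2, hA.err_charFun i] with y h1 h2 h3
  exact ⟨inferInstance, h1, h2, h3⟩

/-- Conditionally on income, the latent variables and the measurement errors are
mutually independent. -/
theorem BaselineAssumption.ae_condDistrib_eq_prod (hA : BaselineAssumption v μ)
    (p : CESParams T) : ∀ᵐ y ∂(μ.map v.income),
      condDistrib (fun ω => (v.normLatent p ω, fun j => v.err (measErrIdx j) ω)) v.income μ y =
        (condDistrib (v.normLatent p) v.income μ y).prod
          (Measure.pi fun j => condDistrib (v.err (measErrIdx j)) v.income μ y) := by
  have hE : Measurable fun ω j => v.err (measErrIdx j) ω :=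
    measurable_pi_lambda _ fun j => v.measurable_err _
  have h1 : CondIndepFun v.incomeσ v.incomeσ_le (v.normLatent p)
      (fun ω j => v.err (measErrIdx j) ω) μ := by
    have h := hA.err_latent_indep.symm
    have hφ : Measurable fun x : (Fin (T + 1) → ℝ) × (Fin T → ℝ) =>
        (Sum.elim (fun t => p.muθ t 0 + p.lamθ t 0 * Real.log (x.1 t))
          (fun t => p.muI t 0 + p.lamI t 0 * Real.log (x.2 t)) : LatIdx T → ℝ) := by
      refine measurable_pi_lambda _ fun j => ?_
      rcases j with t | t <;> simp only [Sum.elim_inl, Sum.elim_inr] <;> fun_prop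
    have hψ : Measurable fun (x : ErrIdx T → ℝ) (j : LatIdx T × Fin 2) => x (measErrIdx j) := by
      fun_prop
    exact h.comp hφ hψ
  have h2 : iCondIndepFun v.incomeσ v.incomeσ_le (fun j => v.err (measErrIdx j)) μ :=
    Kernel.iIndepFun.precomp measErrIdx_injective hA.err_indep
  filter_upwards [condDistrib_prodMk_eq_prod (v.measurable_normLatent p) hE v.measurable_income h1,
    condDistrib_pi_eq_pi (fun j => v.measurable_err (measErrIdx j)) v.measurable_income h2]
    with y h3 h4
  rw [h3, h4]

variable {Ω' : Type} [MeasurableSpace Ω'] [StandardBorelSpace Ω'] {μ' : Measure Ω'}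
  [IsProbabilityMeasure μ'] {v' : SkillVars T Ω'}

/-- Observationally equivalent structures with the same relative intercepts and loadings have
the same joint distribution of income and the normalized latent variables. -/
theorem normLatent_law_eq {p p' : CESParams T} (hp : p.Admissible) (hp' : p'.Admissible)
    (hA : BaselineAssumption v μ) (hA' : BaselineAssumption v' μ')
    (hobs : μ.map (v.observed p) = μ'.map (v'.observed p'))
    (hi : p.transformed.intercept = p'.transformed.intercept)
    (hl : p.transformed.loading = p'.transformed.loading) :
    μ.map (fun ω => (v.income ω, v.normLatent p ω)) =
      μ'.map (fun ω => (v'.income ω, v'.normLatent p' ω)) := by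
  have hM := SkillData.measurable_measures (T := T)
  have hinc : μ.map v.income = μ'.map v'.income := by
    have hf : Measurable fun d : SkillData T => d.2.2.1 := by fun_prop
    have := congrArg (Measure.map fun d : SkillData T => d.2.2.1) hobs
    rwa [Measure.map_map hf (v.measurable_observed p),
      Measure.map_map hf (v'.measurable_observed p')] at this
  have hcd : condDistrib (fun ω => SkillData.measures (v.observed p ω)) v.income μ =
      condDistrib (fun ω => SkillData.measures (v'.observed p' ω)) v'.income μ' := by
    have hf : Measurable fun d : SkillData T => (d.2.2.1, SkillData.measures d) :=
      (by fun_prop : Measurable fun d : SkillData T => d.2.2.1).prodMk hM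
    have := congrArg (Measure.map fun d : SkillData T => (d.2.2.1, SkillData.measures d)) hobs
    rw [Measure.map_map hf (v.measurable_observed p),
      Measure.map_map hf (v'.measurable_observed p')] at this
    -- `condDistrib` is defined from the joint law alone, so equal joint laws give equal kernels,
    -- not merely almost everywhere.
    simp only [condDistrib]
    congr 1
  have key : ∀ {Ω : Type} [MeasurableSpace Ω] [StandardBorelSpace Ω] {μ : Measure Ω}
      [IsProbabilityMeasure μ] {v : SkillVars T Ω} {p : CESParams T}, p.Admissible →
      BaselineAssumption v μ → ∀ᵐ y ∂(μ.map v.income),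
      condDistrib (fun ω => SkillData.measures (v.observed p ω)) v.income μ y =
      ((condDistrib (v.normLatent p) v.income μ y).prod
          (Measure.pi fun j => condDistrib (v.err (measErrIdx j)) v.income μ y)).map
        (measurementMap p.transformed.intercept p.transformed.loading) := by
    intro Ω _ _ μ _ v p hp hA
    have hE : Measurable fun ω j => v.err (measErrIdx j) ω :=
      measurable_pi_lambda _ fun j => v.measurable_err _
    have h1 := condDistrib_comp (μ := μ) (mβ := MeasurableSpace.pi) v.income
      ((v.measurable_normLatent p).prodMk hE).aemeasurable
      (measurable_measurementMap p.transformed.intercept p.transformed.loading)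
    filter_upwards [h1, hA.ae_condDistrib_eq_prod p] with y h1 h2
    rw [Kernel.map_apply _ (measurable_measurementMap _ _), h2] at h1
    rw [← h1]
    congr 2
    funext ω
    exact v.measures_observed hp ω
  have h1 := key hp hA
  have h2 := key hp' hA'
  have e1 := ae_all_iff.2 fun j => hA.ae_errorLaw (measErrIdx j)
  have e2 := ae_all_iff.2 fun j => hA'.ae_errorLaw (measErrIdx j)
  rw [← hinc] at h2 e2
  -- Deconvolution is applied separately at almost every income history; the error laws of the two
  -- structures may depend on income and need not be known to agree.
  have hlat : condDistrib (v.normLatent p) v.income μ =ᵐ[μ.map v.income]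
      condDistrib (v'.normLatent p') v'.income μ' := by
    filter_upwards [h1, h2, e1, e2] with y h1 h2 e1 e2
    rw [hcd, h2, ← hi, ← hl] at h1
    exact latent_law_eq hp.loading_zero hp.loading_one_ne e1 e2 h1.symm
  rw [← compProd_map_condDistrib (v.measurable_normLatent p).aemeasurable,
    ← compProd_map_condDistrib (v'.measurable_normLatent p').aemeasurable, ← hinc]
  exact Measure.compProd_congr hlat

end Model

-- Relative loadings and intercepts from first and second moments.

/-- Conditionally independent variables are uncorrelated if one of them has conditional
mean zero. -/
theorem integral_mul_eq_zero_of_condIndepFun {Ω 𝓨 : Type*} [MeasurableSpace Ω]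
    [StandardBorelSpace Ω] [m𝓨 : MeasurableSpace 𝓨] {μ : Measure Ω} [IsProbabilityMeasure μ]
    {Y : Ω → 𝓨} {f g : Ω → ℝ} (hf : Measurable f) (hg : Measurable g) (hY : Measurable Y)
    (hf2 : MemLp f 2 μ) (hg2 : MemLp g 2 μ)
    (h : CondIndepFun (MeasurableSpace.comap Y m𝓨) hY.comap_le f g μ)
    (h0 : μ[f | MeasurableSpace.comap Y m𝓨] =ᵐ[μ] 0) : ∫ ω, f ω * g ω ∂μ = 0 := by
  have hfg : Integrable (fun ω => f ω * g ω) μ := hf2.integrable_mul hg2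
  have h1 := condExp_ae_eq_integral_condDistrib (f := fun x : ℝ × ℝ => x.1 * x.2) hY
    (hf.prodMk hg).aemeasurable (by fun_prop : Continuous fun x : ℝ × ℝ =>
      x.1 * x.2).stronglyMeasurable hfg
  have h2 := condExp_ae_eq_integral_condDistrib' hY (hf2.integrable one_le_two)
  have h3 := ae_of_ae_map hY.aemeasurable (condDistrib_prodMk_eq_prod hf hg hY h)
  rw [← integral_condExp hY.comap_le]
  refine integral_eq_zero_of_ae ?_
  filter_upwards [h0, h1, h2, h3] with ω h0 h1 h2 h3
  rw [h1, h3, integral_prod_mul (fun x : ℝ => x) (fun x : ℝ => x), ← h2, h0]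
  simp

/-- The scalar observables other than income. -/
def SkillData.scalar {T : ℕ} (d : SkillData T) : ErrIdx T → ℝ
  | .inl (t, m) => d.1 t m
  | .inr (.inl (t, m)) => d.2.1 t m
  | .inr (.inr _) => d.2.2.2

theorem SkillData.measurable_scalar {T : ℕ} (i : ErrIdx T) :
    Measurable fun d : SkillData T => d.scalar i := by
  rcases i with ⟨t, m⟩ | ⟨t, m⟩ | _ <;> simp only [SkillData.scalar] <;> fun_prop

namespace CESParams

variable {T : ℕ}

/-- Intercepts of the measurement and outcome equations. -/
def icpt (p : CESParams T) : ErrIdx T → ℝ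
  | .inl (t, m) => p.muθ t m
  | .inr (.inl (t, m)) => p.muI t m
  | .inr (.inr _) => p.ρ0

/-- Slopes of the measurement and outcome equations. -/
def slp (p : CESParams T) : ErrIdx T → ℝ
  | .inl (t, m) => p.lamθ t m
  | .inr (.inl (t, m)) => p.lamI t m
  | .inr (.inr _) => p.ρ1

end CESParams

/-- The log latent variable entering each measurement or outcome equation. -/
noncomputable def SkillVars.regressor {T : ℕ} {Ω : Type} [MeasurableSpace Ω]
    (v : SkillVars T Ω) : ErrIdx T → Ω → ℝ
  | .inl (t, _) => v.logθ t
  | .inr (.inl (t, _)) => v.logI t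
  | .inr (.inr _) => v.logθ (Fin.last T)

theorem SkillVars.scalar_observed {T : ℕ} {Ω : Type} [MeasurableSpace Ω] (v : SkillVars T Ω)
    (p : CESParams T) (i : ErrIdx T) (ω : Ω) :
    SkillData.scalar (v.observed p ω) i = p.icpt i + (p.slp i * v.regressor i ω + v.err i ω) := by
  rcases i with ⟨t, m⟩ | ⟨t, m⟩ | _ <;> exact add_assoc _ _ _

theorem SkillVars.measurable_regressor {T : ℕ} {Ω : Type} [MeasurableSpace Ω] (v : SkillVars T Ω) :
    ∀ i, Measurable (v.regressor i)
  | .inl (t, _) => v.measurable_logθ t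
  | .inr (.inl (t, _)) => v.measurable_logI t
  | .inr (.inr _) => v.measurable_logθ (Fin.last T)

namespace BaselineAssumption

variable {T : ℕ} {Ω : Type} [MeasurableSpace Ω] [StandardBorelSpace Ω] {μ : Measure Ω}
  [IsProbabilityMeasure μ] {v : SkillVars T Ω}

theorem memLp_regressor (hA : BaselineAssumption v μ) : ∀ i, MemLp (v.regressor i) 2 μ
  | .inl (t, _) => hA.memLp_logθ t
  | .inr (.inl (t, _)) => hA.memLp_logI t
  | .inr (.inr _) => hA.memLp_logθ (Fin.last T)

theorem integral_err (hA : BaselineAssumption v μ) (i : ErrIdx T) : ∫ ω, v.err i ω ∂μ = 0 := by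
  rw [← integral_condExp v.incomeσ_le, integral_congr_ae (hA.err_mean i)]
  simp

theorem covariance_err_err (hA : BaselineAssumption v μ) {i j : ErrIdx T} (hij : i ≠ j) :
    covariance (v.err i) (v.err j) μ = 0 := by
  rw [covariance_eq_sub (hA.memLp_err i) (hA.memLp_err j), hA.integral_err, zero_mul, sub_zero]
  exact integral_mul_eq_zero_of_condIndepFun (v.measurable_err i) (v.measurable_err j)
    v.measurable_income (hA.memLp_err i) (hA.memLp_err j) (hA.err_indep.condIndepFun hij)
    (hA.err_mean i)

theorem covariance_err_regressor (hA : BaselineAssumption v μ) (i j : ErrIdx T) :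
    covariance (v.err i) (v.regressor j) μ = 0 := by
  rw [covariance_eq_sub (hA.memLp_err i) (hA.memLp_regressor j), hA.integral_err, zero_mul,
    sub_zero]
  refine integral_mul_eq_zero_of_condIndepFun (v.measurable_err i) (v.measurable_regressor j)
    v.measurable_income (hA.memLp_err i) (hA.memLp_regressor j) ?_ (hA.err_mean i)
  have hφ : Measurable fun x : ErrIdx T → ℝ => x i := measurable_pi_apply i
  have hθ : ∀ t, Measurable fun x : (Fin (T + 1) → ℝ) × (Fin T → ℝ) => Real.log (x.1 t) :=
    fun t => by fun_prop
  have hI : ∀ t, Measurable fun x : (Fin (T + 1) → ℝ) × (Fin T → ℝ) => Real.log (x.2 t) :=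
    fun t => by fun_prop
  rcases j with ⟨t, m⟩ | ⟨t, m⟩ | _
  · exact hA.err_latent_indep.comp hφ (hθ t)
  · exact hA.err_latent_indep.comp hφ (hI t)
  · exact hA.err_latent_indep.comp hφ (hθ (Fin.last T))

/-- Distinct errors are uncorrelated with each other and with the latent variables, so only the
systematic parts contribute. -/
theorem covariance_scalar (hA : BaselineAssumption v μ) (p : CESParams T) {i j : ErrIdx T}
    (hij : i ≠ j) :
    covariance (fun ω => (v.observed p ω).scalar i) (fun ω => (v.observed p ω).scalar j) μ =
      p.slp i * p.slp j * covariance (v.regressor i) (v.regressor j) μ := by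
  have hr : ∀ i, MemLp (fun ω => p.slp i * v.regressor i ω) 2 μ := fun i =>
    (hA.memLp_regressor i).const_mul _
  have hre : ∀ i, MemLp ((fun ω => p.slp i * v.regressor i ω) + v.err i) 2 μ := fun i =>
    (hr i).add (hA.memLp_err i)
  simp only [SkillVars.scalar_observed]
  change covariance (fun ω => p.icpt i + ((fun ω => p.slp i * v.regressor i ω) + v.err i) ω)
    (fun ω => p.icpt j + ((fun ω => p.slp j * v.regressor j ω) + v.err j) ω) μ = _
  rw [covariance_const_add_left ((hre i).integrable one_le_two),
    covariance_const_add_right ((hre j).integrable one_le_two)]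
  rw [covariance_add_left (hr i) (hA.memLp_err i) (hre j),
    covariance_add_right (hr i) (hr j) (hA.memLp_err j),
    covariance_add_right (hA.memLp_err i) (hr j) (hA.memLp_err j),
    hA.covariance_err_err hij, covariance_const_mul_left, covariance_const_mul_left,
    covariance_const_mul_right, covariance_const_mul_right, hA.covariance_err_regressor,
    covariance_comm _ (v.err j), hA.covariance_err_regressor]
  ring

theorem integral_scalar (hA : BaselineAssumption v μ) (p : CESParams T) (i : ErrIdx T) :
    ∫ ω, (v.observed p ω).scalar i ∂μ = p.icpt i + p.slp i * ∫ ω, v.regressor i ω ∂μ := by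
  have hr : Integrable (fun ω => p.slp i * v.regressor i ω) μ :=
    ((hA.memLp_regressor i).integrable one_le_two).const_mul _
  have he : Integrable (v.err i) μ := (hA.memLp_err i).integrable one_le_two
  have hre : Integrable (fun ω => p.slp i * v.regressor i ω + v.err i ω) μ := hr.add he
  simp only [SkillVars.scalar_observed]
  rw [integral_add (integrable_const _) hre, integral_add hr he, hA.integral_err,
    integral_const_mul]
  simp

variable {Ω' : Type} [MeasurableSpace Ω'] [StandardBorelSpace Ω'] {μ' : Measure Ω'}
  [IsProbabilityMeasure μ'] {v' : SkillVars T Ω'}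

/-- The slope and intercept of an equation relative to another one with the same regressor are
determined by the distribution of the observables. -/
theorem relative_coef_eq (hA : BaselineAssumption v μ) (hA' : BaselineAssumption v' μ')
    {p p' : CESParams T} (hobs : μ.map (v.observed p) = μ'.map (v'.observed p'))
    {i k j : ErrIdx T} (hij : i ≠ j) (hkj : k ≠ j) (hreg : v.regressor i = v.regressor k)
    (hreg' : v'.regressor i = v'.regressor k) (hk : p.slp k ≠ 0) (hk' : p'.slp k ≠ 0)
    (hj : p.slp j ≠ 0) (hcov : covariance (v.regressor k) (v.regressor j) μ ≠ 0) :
    p.slp i / p.slp k = p'.slp i / p'.slp k ∧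
      p.icpt i - p.slp i / p.slp k * p.icpt k = p'.icpt i - p'.slp i / p'.slp k * p'.icpt k := by
  have hc : ∀ i j : ErrIdx T,
      covariance (fun ω => (v.observed p ω).scalar i) (fun ω => (v.observed p ω).scalar j) μ =
      covariance (fun ω => (v'.observed p' ω).scalar i)
        (fun ω => (v'.observed p' ω).scalar j) μ' := by
    intro i j
    have hi := SkillData.measurable_scalar i
    have hj := SkillData.measurable_scalar j
    have h1 := covariance_map (μ := μ) (Z := v.observed p) hi.aestronglyMeasurable
      hj.aestronglyMeasurable (v.measurable_observed p).aemeasurable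
    have h2 := covariance_map (μ := μ') (Z := v'.observed p') hi.aestronglyMeasurable
      hj.aestronglyMeasurable (v'.measurable_observed p').aemeasurable
    rw [hobs] at h1
    exact h1.symm.trans h2
  have hm : ∀ i : ErrIdx T, ∫ ω, (v.observed p ω).scalar i ∂μ =
      ∫ ω, (v'.observed p' ω).scalar i ∂μ' := by
    intro i
    have hi := SkillData.measurable_scalar i
    rw [← integral_map (v.measurable_observed p).aemeasurable hi.aestronglyMeasurable, hobs,
      integral_map (v'.measurable_observed p').aemeasurable hi.aestronglyMeasurable]
  have c1 := hc i j
  have c2 := hc k j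
  rw [hA.covariance_scalar p hij, hA'.covariance_scalar p' hij, hreg, hreg'] at c1
  rw [hA.covariance_scalar p hkj, hA'.covariance_scalar p' hkj] at c2
  have m1 := hm i
  have m2 := hm k
  rw [hA.integral_scalar p, hA'.integral_scalar p', hreg, hreg'] at m1
  rw [hA.integral_scalar p, hA'.integral_scalar p'] at m2
  -- Equations `i` and `k` share their regressor, so its unknown covariance with the regressor of
  -- `j` cancels from the ratio. Nonvanishing is needed in the first structure only.
  have hr : p.slp i / p.slp k = p'.slp i / p'.slp k := by
    rw [div_eq_div_iff hk hk']
    refine mul_right_cancel₀ (mul_ne_zero (mul_ne_zero hk hj) hcov) ?_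
    linear_combination (p'.slp k * p.slp k) * c1 - (p'.slp i * p.slp k) * c2
  refine ⟨hr, ?_⟩
  have e1 : p.slp i = p.slp i / p.slp k * p.slp k := (div_mul_cancel₀ _ hk).symm
  have e2 : p'.slp i = p'.slp i / p'.slp k * p'.slp k := (div_mul_cancel₀ _ hk').symm
  rw [e1, e2] at m1
  rw [hr] at m1 ⊢
  linear_combination m1 - (p'.slp i / p'.slp k) * m2

/-- The relative coefficients of the measurement and outcome equations are identified. -/
theorem measurement_eq (hA : BaselineAssumption v μ) (hA' : BaselineAssumption v' μ')
    {p p' : CESParams T} (hp : p.Admissible) (hp' : p'.Admissible)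
    (hobs : μ.map (v.observed p) = μ'.map (v'.observed p')) :
    p.transformed.muθ = p'.transformed.muθ ∧ p.transformed.lamθ = p'.transformed.lamθ ∧
    p.transformed.muI = p'.transformed.muI ∧ p.transformed.lamI = p'.transformed.lamI ∧
    p.transformed.ρ0 = p'.transformed.ρ0 ∧ p.transformed.ρ1 = p'.transformed.ρ1 := by
  -- Formulated for any equation whose regressor is the log skill at `t`, so that it covers the
  -- adult outcome as well as the skill measures.
  have hθ : ∀ t (i : ErrIdx T), (∀ s m, s ≠ t → i ≠ .inl (s, m)) →
      (∀ s m, i ≠ .inr (.inl (s, m))) → v.regressor i = v.logθ t → v'.regressor i = v'.logθ t →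
      p.slp i / p.lamθ t 0 = p'.slp i / p'.lamθ t 0 ∧
      p.icpt i - p.slp i / p.lamθ t 0 * p.muθ t 0 =
        p'.icpt i - p'.slp i / p'.lamθ t 0 * p'.muθ t 0 := by
    intro t i h1 h2 h3 h4
    rcases hA.cov_θ t with ⟨s, hs⟩ | ⟨s, hst, hs⟩
    · exact hA.relative_coef_eq hA' hobs (k := .inl (t, 0)) (j := .inr (.inl (s, 0))) (h2 s 0)
        (by simp) h3 h4 (hp.lamθ_ne t 0) (hp'.lamθ_ne t 0) (hp.lamI_ne s 0) hs
    · exact hA.relative_coef_eq hA' hobs (k := .inl (t, 0)) (j := .inl (s, 0)) (h1 s 0 hst)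
        (by simpa using hst.symm) h3 h4 (hp.lamθ_ne t 0) (hp'.lamθ_ne t 0) (hp.lamθ_ne s 0) hs
  have hI : ∀ t m, p.lamI t m / p.lamI t 0 = p'.lamI t m / p'.lamI t 0 ∧
      p.muI t m - p.lamI t m / p.lamI t 0 * p.muI t 0 =
        p'.muI t m - p'.lamI t m / p'.lamI t 0 * p'.muI t 0 := by
    intro t m
    rcases hA.cov_I t with ⟨s, hs⟩ | ⟨s, hst, hs⟩
    · exact hA.relative_coef_eq hA' hobs (i := .inr (.inl (t, m))) (k := .inr (.inl (t, 0)))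
        (j := .inl (s, 0)) (by simp) (by simp) rfl rfl (hp.lamI_ne t 0) (hp'.lamI_ne t 0)
        (hp.lamθ_ne s 0) hs
    · exact hA.relative_coef_eq hA' hobs (i := .inr (.inl (t, m))) (k := .inr (.inl (t, 0)))
        (j := .inr (.inl (s, 0))) (by simp [hst.symm]) (by simp [hst.symm]) rfl rfl
        (hp.lamI_ne t 0) (hp'.lamI_ne t 0) (hp.lamI_ne s 0) hs
  have hθm := fun t m => hθ t (.inl (t, m)) (by simp +contextual [eq_comm]) (by simp) rfl rfl
  have hQ := hθ (Fin.last T) (.inr (.inr ())) (by simp) (by simp) rfl rfl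
  refine ⟨?_, ?_, ?_, ?_, ?_, hQ.1⟩
  · funext t m; exact (hθm t m).2
  · funext t m; exact (hθm t m).1
  · funext t m; exact (hI t m).2
  · funext t m; exact (hI t m).1
  · have h := hQ.2
    simp only [CESParams.icpt, CESParams.slp] at h
    simp only [CESParams.transformed, mul_div_right_comm]
    exact h

end BaselineAssumption

-- Regression functions and the support condition.

/-- Used to move conditional-mean assumptions between primitive and normalised variables: an
invertible measurable change of variables does not alter the conditioning information. -/
theorem comap_eq_comap_of_comp {Ω α β : Type*} [mα : MeasurableSpace α] [mβ : MeasurableSpace β]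
    {f : Ω → α} {g : Ω → β} {F : α → β} {G : β → α} (hF : Measurable F) (hG : Measurable G)
    (hg : ∀ ω, g ω = F (f ω)) (hf : ∀ ω, f ω = G (g ω)) :
    MeasurableSpace.comap f mα = MeasurableSpace.comap g mβ := by
  refine le_antisymm ?_ ?_
  · rw [show f = G ∘ g from funext hf, ← MeasurableSpace.comap_comp]
    exact MeasurableSpace.comap_mono hG.comap_le
  · rw [show g = F ∘ f from funext hg, ← MeasurableSpace.comap_comp]
    exact MeasurableSpace.comap_mono hF.comap_le

/-- The regression function is determined by the joint distribution. -/
theorem regression_ae_eq {Ω Ω' : Type} {F : Type*} [MeasurableSpace Ω] [MeasurableSpace Ω']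
    [mF : MeasurableSpace F] {μ : Measure Ω} {μ' : Measure Ω'} [IsProbabilityMeasure μ]
    [IsProbabilityMeasure μ'] {U : Ω → F} {U' : Ω' → F} {W : Ω → ℝ} {W' : Ω' → ℝ} {g g' : F → ℝ}
    (hU : Measurable U) (hU' : Measurable U') (hW : Measurable W) (hW' : Measurable W')
    (hg : Measurable g) (hg' : Measurable g') (iW : Integrable W μ) (iW' : Integrable W' μ')
    (iR : Integrable (fun ω => W ω - g (U ω)) μ) (iR' : Integrable (fun ω => W' ω - g' (U' ω)) μ')
    (hR : μ[fun ω => W ω - g (U ω) | MeasurableSpace.comap U mF] =ᵐ[μ] 0)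
    (hR' : μ'[fun ω => W' ω - g' (U' ω) | MeasurableSpace.comap U' mF] =ᵐ[μ'] 0)
    (hlaw : μ.map (fun ω => (U ω, W ω)) = μ'.map (fun ω => (U' ω, W' ω))) :
    ∀ᵐ ω ∂μ, g (U ω) = g' (U ω) := by
  have hlawU : μ.map U = μ'.map U' := by
    have := congrArg (Measure.map Prod.fst) hlaw
    rwa [Measure.map_map measurable_fst (hU.prodMk hW),
      Measure.map_map measurable_fst (hU'.prodMk hW')] at this
  -- The integrals of the regression function over measurable sets are read off from the joint law
  -- of regressors and outcome.
  have key : ∀ {Ω : Type} [MeasurableSpace Ω] {μ : Measure Ω} [IsProbabilityMeasure μ]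
      {U : Ω → F} {W : Ω → ℝ} {g : F → ℝ}, Measurable U → Measurable W → Measurable g →
      Integrable W μ → Integrable (fun ω => W ω - g (U ω)) μ →
      μ[fun ω => W ω - g (U ω) | MeasurableSpace.comap U mF] =ᵐ[μ] 0 →
      Integrable g (μ.map U) ∧ ∀ s, MeasurableSet s →
        ∫ u in s, g u ∂(μ.map U) = ∫ x in s ×ˢ Set.univ, x.2 ∂(μ.map fun ω => (U ω, W ω)) := by
    intro Ω _ μ _ U W g hU hW hg iW iR hR
    have ig : Integrable (fun ω => g (U ω)) μ := by
      refine (iW.sub iR).congr (Eventually.of_forall fun ω => ?_)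
      simp
    refine ⟨(integrable_map_measure hg.aestronglyMeasurable hU.aemeasurable).2 ig,
      fun s hs => ?_⟩
    rw [setIntegral_map hs hg.aestronglyMeasurable hU.aemeasurable,
      setIntegral_map (hs.prod MeasurableSet.univ) measurable_snd.aestronglyMeasurable
        (hU.prodMk hW).aemeasurable]
    have h1 : ∫ ω in U ⁻¹' s, (W ω - g (U ω)) ∂μ = 0 := by
      rw [← setIntegral_condExp hU.comap_le iR ⟨s, hs, rfl⟩,
        setIntegral_congr_ae (g := fun _ => (0 : ℝ)) (hU hs)
          (hR.mono fun ω h _ => h)]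
      simp
    rw [integral_sub iW.integrableOn ig.integrableOn, sub_eq_zero] at h1
    rw [← h1]
    congr 2
    ext ω
    simp
  obtain ⟨i1, k1⟩ := key hU hW hg iW iR hR
  have k2 := key hU' hW' hg' iW' iR' hR'
  rw [← hlawU, ← hlaw] at k2
  obtain ⟨i2, k2⟩ := k2
  exact ae_of_ae_map hU.aemeasurable (i1.ae_eq_of_forall_setIntegral_eq _ _ i2
    fun s hs _ => (k1 s hs).trans (k2 s hs).symm)

namespace BaselineAssumption

variable {T : ℕ} {Ω : Type} [MeasurableSpace Ω] [StandardBorelSpace Ω] {μ : Measure Ω}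
  [IsProbabilityMeasure μ] {v : SkillVars T Ω}

/-- The support of `(θₜ, Iₜ, Yₜ)` contains a nonempty open subset of the positive orthant. -/
theorem exists_open_support (hA : BaselineAssumption v μ) (t : Fin T) :
    ∃ V : Set (ℝ × ℝ × ℝ), IsOpen V ∧ V.Nonempty ∧ (∀ x ∈ V, 0 < x.1 ∧ 0 < x.2.1 ∧ 0 < x.2.2) ∧
      ∀ x ∈ V, ∀ N ∈ 𝓝 x, 0 < μ {ω | (v.θ t.castSucc ω, v.inv t ω, v.Y t ω) ∈ N} := by
  obtain ⟨c, r, hr, hb⟩ := hA.support_ball t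
  have hm : Measurable fun ω => (v.θ t.castSucc ω, v.inv t ω, v.Y t ω) :=
    (v.measurable_θ _).prodMk ((v.measurable_inv t).prodMk (v.measurable_Y t))
  have hpos : ∀ x ∈ Metric.ball c r, ∀ N ∈ 𝓝 x,
      0 < μ {ω | (v.θ t.castSucc ω, v.inv t ω, v.Y t ω) ∈ N} := by
    intro x hx N hN
    obtain ⟨N', hN', ho, hxN⟩ := mem_nhds_iff.1 hN
    have h1 := (Measure.mem_support_iff_forall _).1 (hb hx) N' (ho.mem_nhds hxN)
    rw [Measure.map_apply hm ho.measurableSet] at h1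
    exact h1.trans_le (measure_mono fun ω h => hN' h)
  have hO : IsOpen {x : ℝ × ℝ × ℝ | 0 < x.1 ∧ 0 < x.2.1 ∧ 0 < x.2.2} :=
    (isOpen_lt continuous_const continuous_fst).inter
      ((isOpen_lt continuous_const (continuous_fst.comp continuous_snd)).inter
        (isOpen_lt continuous_const (continuous_snd.comp continuous_snd)))
  refine ⟨Metric.ball c r ∩ {x | 0 < x.1 ∧ 0 < x.2.1 ∧ 0 < x.2.2}, Metric.isOpen_ball.inter hO,
    ?_, fun x hx => hx.2, fun x hx => hpos x hx.1⟩
  -- The ball might leave the positive orthant, but it has positive mass, so it contains a realised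
  -- and hence positive point.
  obtain ⟨ω, hω⟩ := nonempty_of_measure_ne_zero
    (hpos c (Metric.mem_ball_self hr) _ (Metric.ball_mem_nhds c hr)).ne'
  exact ⟨_, hω, v.θ_pos _ _, v.inv_pos _ _, v.Y_pos _ _⟩

/-- A continuous function of the affinely transformed log skill, log investment and log income
that vanishes almost surely vanishes on an open set. -/
theorem exists_eventually_eq_zero (hA : BaselineAssumption v μ) (t : Fin T) {a b a' b' : ℝ}
    (hb : b ≠ 0) (hb' : b' ≠ 0) {D : ℝ × ℝ × ℝ → ℝ} (hD : Continuous D)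
    (h : ∀ᵐ ω ∂μ, D (a + b * v.logθ t.castSucc ω, a' + b' * v.logI t ω, v.logY t ω) = 0) :
    ∃ w, ∀ᶠ x in 𝓝 w, D x = 0 := by
  obtain ⟨V, hV, ⟨x₀, hx₀⟩, hVpos, hVm⟩ := hA.exists_open_support t
  set φ : ℝ × ℝ × ℝ → ℝ × ℝ × ℝ := fun x =>
    (a + b * Real.log x.1, a' + b' * Real.log x.2.1, Real.log x.2.2) with hφ
  set χ : ℝ × ℝ × ℝ → ℝ × ℝ × ℝ := fun y =>
    (Real.exp ((y.1 - a) / b), Real.exp ((y.2.1 - a') / b'), Real.exp y.2.2) with hχ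
  have hχc : Continuous χ := by fun_prop
  have hφχ : ∀ y, φ (χ y) = y := by
    intro y
    simp only [hφ, hχ, Real.log_exp]
    rw [mul_div_cancel₀ _ hb, mul_div_cancel₀ _ hb']
    simp
  have hχφ : ∀ x ∈ V, χ (φ x) = x := by
    intro x hx
    obtain ⟨h1, h2, h3⟩ := hVpos x hx
    simp only [hφ, hχ, add_sub_cancel_left, mul_div_cancel_left₀ _ hb,
      mul_div_cancel_left₀ _ hb', Real.exp_log h1, Real.exp_log h2, Real.exp_log h3]
  -- A nonzero value would persist on a neighbourhood, which has positive probability.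
  have hzero : ∀ x ∈ V, D (φ x) = 0 := by
    intro x hx
    by_contra hne
    obtain ⟨h1, h2, h3⟩ := hVpos x hx
    have hφc : ContinuousAt φ x := by
      have l1 : ContinuousAt (fun x : ℝ × ℝ × ℝ => Real.log x.1) x :=
        (by fun_prop : ContinuousAt (fun x : ℝ × ℝ × ℝ => x.1) x).log h1.ne'
      have l2 : ContinuousAt (fun x : ℝ × ℝ × ℝ => Real.log x.2.1) x :=
        (by fun_prop : ContinuousAt (fun x : ℝ × ℝ × ℝ => x.2.1) x).log h2.ne'
      have l3 : ContinuousAt (fun x : ℝ × ℝ × ℝ => Real.log x.2.2) x :=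
        (by fun_prop : ContinuousAt (fun x : ℝ × ℝ × ℝ => x.2.2) x).log h3.ne'
      exact (continuousAt_const.add (continuousAt_const.mul l1)).prodMk
        ((continuousAt_const.add (continuousAt_const.mul l2)).prodMk l3)
    have hN : ∀ᶠ y in 𝓝 x, D (φ y) ≠ 0 :=
      (ContinuousAt.comp (g := D) hD.continuousAt hφc).eventually_ne hne
    refine (hVm x hx _ hN).ne' ?_
    exact measure_mono_null (fun ω hω => hω) (ae_iff.1 h)
  refine ⟨φ x₀, ?_⟩
  have : ∀ᶠ y in 𝓝 (φ x₀), χ y ∈ V :=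
    hχc.continuousAt.eventually (hV.mem_nhds (by rwa [hχφ x₀ hx₀]))
  filter_upwards [this] with y hy
  rw [← hφχ y]
  exact hzero _ hy

end BaselineAssumption

-- The model equations in normalised units.

namespace SkillVars

variable {T : ℕ} {Ω : Type} [MeasurableSpace Ω] {v : SkillVars T Ω}

/-- The log skill in the units and with the location of its first measure. -/
noncomputable def normθ (v : SkillVars T Ω) (p : CESParams T) (t : Fin (T + 1)) (ω : Ω) : ℝ :=
  p.muθ t 0 + p.lamθ t 0 * v.logθ t ω

/-- The log investment in the units and with the location of its first measure. -/
noncomputable def normI (v : SkillVars T Ω) (p : CESParams T) (t : Fin T) (ω : Ω) : ℝ :=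
  p.muI t 0 + p.lamI t 0 * v.logI t ω

theorem measurable_logY (v : SkillVars T Ω) (t : Fin T) : Measurable (v.logY t) :=
  (v.measurable_Y t).log

theorem measurable_normθ (v : SkillVars T Ω) (p : CESParams T) (t : Fin (T + 1)) :
    Measurable (v.normθ p t) :=
  ((v.measurable_logθ t).const_mul _).const_add _

theorem measurable_normI (v : SkillVars T Ω) (p : CESParams T) (t : Fin T) :
    Measurable (v.normI p t) :=
  ((v.measurable_logI t).const_mul _).const_add _

theorem exp_logθ (v : SkillVars T Ω) (t : Fin (T + 1)) (ω : Ω) :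
    Real.exp (v.logθ t ω) = v.θ t ω := Real.exp_log (v.θ_pos t ω)

theorem exp_logY (v : SkillVars T Ω) (t : Fin T) (ω : Ω) :
    Real.exp (v.logY t ω) = v.Y t ω := Real.exp_log (v.Y_pos t ω)

theorem rpow_θ (v : SkillVars T Ω) (t : Fin (T + 1)) (ω : Ω) (s : ℝ) :
    v.θ t ω ^ s = Real.exp (s * v.logθ t ω) := by
  rw [Real.rpow_def_of_pos (v.θ_pos _ _), mul_comm]; rfl

theorem rpow_inv (v : SkillVars T Ω) (t : Fin T) (ω : Ω) (s : ℝ) :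
    v.inv t ω ^ s = Real.exp (s * v.logI t ω) := by
  rw [Real.rpow_def_of_pos (v.inv_pos _ _), mul_comm]; rfl

end SkillVars

/-- The log of the rewritten production technology. -/
noncomputable def CESTransformed.logCES {T : ℕ} (τ : CESTransformed T) (t : Fin T) (x z : ℝ) : ℝ :=
  τ.expOut t * Real.log (τ.γ1 t * Real.exp (τ.expθ t * x) + τ.γ2 t * Real.exp (τ.expI t * z))

theorem CESParams.Admissible.ces_pos {T : ℕ} {p : CESParams T} (hp : p.Admissible) (t : Fin T)
    (x z : ℝ) : 0 < p.γ1 t * Real.exp (p.σ t * x) + p.γ2 t * Real.exp (p.σ t * z) :=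
  add_pos (mul_pos (hp.γ1_pos t) (Real.exp_pos _)) (mul_pos (hp.γ2_pos t) (Real.exp_pos _))

/-- The rewritten production technology agrees with the primitive one. -/
theorem CESParams.Admissible.logCES_eq {T : ℕ} {p : CESParams T} (hp : p.Admissible) (t : Fin T)
    (x z : ℝ) : p.transformed.logCES t (p.muθ t.castSucc 0 + p.lamθ t.castSucc 0 * x)
      (p.muI t 0 + p.lamI t 0 * z) = p.muθ t.succ 0 + p.lamθ t.succ 0 * (p.ψ t / p.σ t *
        Real.log (p.γ1 t * Real.exp (p.σ t * x) + p.γ2 t * Real.exp (p.σ t * z))) := by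
  have h1 := hp.lamθ_ne t.castSucc 0
  have h2 := hp.lamθ_ne t.succ 0
  have h3 := hp.lamI_ne t 0
  have h4 := hp.σ_ne t
  have h5 := hp.ψ_ne t
  -- Both transformed weights carry the factor `exp m`; the outer exponent turns it into the
  -- intercept of next period's skill measure.
  set m := p.σ t * (p.muθ t.succ 0 / (p.ψ t * p.lamθ t.succ 0)) with hm
  have hin : p.transformed.γ1 t *
        Real.exp (p.transformed.expθ t * (p.muθ t.castSucc 0 + p.lamθ t.castSucc 0 * x)) +
      p.transformed.γ2 t * Real.exp (p.transformed.expI t * (p.muI t 0 + p.lamI t 0 * z)) =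
      Real.exp m * (p.γ1 t * Real.exp (p.σ t * x) + p.γ2 t * Real.exp (p.σ t * z)) := by
    simp only [CESParams.transformed, mul_add]
    rw [mul_assoc, mul_assoc, ← Real.exp_add, ← Real.exp_add, mul_left_comm (Real.exp m),
      mul_left_comm (Real.exp m), ← Real.exp_add, ← Real.exp_add]
    congr 3 <;> · rw [hm]; field_simp; ring_nf
  rw [CESTransformed.logCES, hin, Real.log_mul (Real.exp_pos _).ne' (hp.ces_pos t x z).ne',
    Real.log_exp, hm]
  simp only [CESParams.transformed]
  field_simp

namespace SkillVars.Equations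

variable {T : ℕ} {Ω : Type} [MeasurableSpace Ω] {v : SkillVars T Ω} {p : CESParams T}

theorem normI_eq (h : v.Equations p) (hp : p.Admissible) (t : Fin T) (ω : Ω) :
    v.normI p t ω = p.transformed.β0 t + p.transformed.β1 t * v.normθ p t.castSucc ω +
      p.transformed.β2 t * v.logY t ω + p.lamI t 0 * v.ηI t ω := by
  have := hp.lamθ_ne t.castSucc 0
  simp only [normI, normθ, h.investment t ω, CESParams.transformed]
  field_simp
  ring

theorem normθ_succ_eq (h : v.Equations p) (hp : p.Admissible) (t : Fin T) (ω : Ω) :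
    v.normθ p t.succ ω = p.transformed.logCES t (v.normθ p t.castSucc ω) (v.normI p t ω) +
      p.lamθ t.succ 0 * v.ηθ t ω := by
  have hS := hp.ces_pos t (v.logθ t.castSucc ω) (v.logI t ω)
  have hlog : v.logθ t.succ ω = p.ψ t / p.σ t *
      Real.log (p.γ1 t * Real.exp (p.σ t * v.logθ t.castSucc ω) +
        p.γ2 t * Real.exp (p.σ t * v.logI t ω)) + v.ηθ t ω := by
    rw [logθ, h.production t ω, v.rpow_θ, v.rpow_inv,
      Real.log_mul (Real.rpow_pos_of_pos hS _).ne' (Real.exp_pos _).ne', Real.log_rpow hS,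
      Real.log_exp]
  simp only [normθ, normI]
  rw [hp.logCES_eq, hlog]
  ring

end SkillVars.Equations

/-- An affine function of two variables that vanishes on an open set is zero. -/
theorem affine_eq_zero_of_eventually {c₀ c₁ c₂ : ℝ} {w : ℝ × ℝ × ℝ}
    (h : ∀ᶠ x in 𝓝 w, c₀ + c₁ * x.1 + c₂ * x.2.2 = 0) : c₀ = 0 ∧ c₁ = 0 ∧ c₂ = 0 := by
  obtain ⟨x₀, z₀, l₀⟩ := w
  have h0 := h.self_of_nhds
  have ex : ∀ {p : ℝ → Prop} {y : ℝ}, (∀ᶠ l in 𝓝 y, p l) → ∃ l, l ≠ y ∧ p l := by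
    intro p y hp
    have h1 : ∀ᶠ l in 𝓝[≠] y, p l := nhdsWithin_le_nhds hp
    obtain ⟨l, hl, hly⟩ := (h1.and self_mem_nhdsWithin).exists
    exact ⟨l, hly, hl⟩
  obtain ⟨x, hx, h1⟩ := ex (((by fun_prop : Continuous fun x : ℝ => (x, z₀, l₀)).tendsto
    x₀).eventually h)
  obtain ⟨l, hl, h2⟩ := ex (((by fun_prop : Continuous fun l : ℝ => (x₀, z₀, l)).tendsto
    l₀).eventually h)
  simp only at h0 h1 h2
  have e1 : c₁ * (x - x₀) = 0 := by linear_combination h1 - h0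
  have e2 : c₂ * (l - l₀) = 0 := by linear_combination h2 - h0
  have e1 := (mul_eq_zero.1 e1).resolve_right (sub_ne_zero.2 hx)
  have e2 := (mul_eq_zero.1 e2).resolve_right (sub_ne_zero.2 hl)
  rw [e1, e2] at h0
  exact ⟨by linarith, e1, e2⟩

theorem condExp_const_mul_eq_zero {Ω : Type*} {m m₀ : MeasurableSpace Ω} {μ : Measure Ω}
    {f : Ω → ℝ} (c : ℝ) (h : μ[f | m] =ᵐ[μ] 0) : μ[fun ω => c * f ω | m] =ᵐ[μ] 0 := by
  have h1 : μ[fun ω => c * f ω | m] =ᵐ[μ] c • μ[f | m] := condExp_smul c f m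
  filter_upwards [h1, h] with ω h1 h
  rw [h1, Pi.smul_apply, h]
  simp

theorem condExp_sub_eq_zero {Ω : Type*} {m m₀ : MeasurableSpace Ω} {μ : Measure Ω}
    [IsFiniteMeasure μ] {f g : Ω → ℝ} (hm : m ≤ m₀) (hf : Integrable f μ) (hg : Integrable g μ)
    (hgm : StronglyMeasurable[m] g) (h : μ[f | m] =ᵐ[μ] g) :
    μ[fun ω => f ω - g ω | m] =ᵐ[μ] 0 := by
  have h1 : μ[fun ω => f ω - g ω | m] =ᵐ[μ] μ[f | m] - μ[g | m] := condExp_sub hf hg m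
  rw [condExp_of_stronglyMeasurable hm hgm hg] at h1
  filter_upwards [h1, h] with ω h1 h
  rw [h1, Pi.sub_apply, h]
  simp

-- Observational equivalence implies equal transformed parameters.

namespace BaselineAssumption

variable {T : ℕ} {Ω : Type} [MeasurableSpace Ω] [StandardBorelSpace Ω] {μ : Measure Ω}
  [IsProbabilityMeasure μ] {v : SkillVars T Ω} {p : CESParams T}

theorem integrable_normθ (hA : BaselineAssumption v μ) (p : CESParams T) (t : Fin (T + 1)) :
    Integrable (v.normθ p t) μ :=
  (integrable_const _).add (((hA.memLp_logθ t).integrable one_le_two).const_mul _)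

theorem integrable_normI (hA : BaselineAssumption v μ) (p : CESParams T) (t : Fin T) :
    Integrable (v.normI p t) μ :=
  (integrable_const _).add (((hA.memLp_logI t).integrable one_le_two).const_mul _)

theorem integrable_ηθ (hA : BaselineAssumption v μ) (t : Fin T) : Integrable (v.ηθ t) μ :=
  (hA.memLp_ηθ t).integrable one_le_two

theorem integrable_ηI (hA : BaselineAssumption v μ) (t : Fin T) : Integrable (v.ηI t) μ :=
  (hA.memLp_ηI t).integrable one_le_two

/-- The rewritten investment equation is a regression equation. -/
theorem investment_regression (hA : BaselineAssumption v μ) (heq : v.Equations p)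
    (hp : p.Admissible) (t : Fin T) :
    Integrable (fun ω => v.normI p t ω - (p.transformed.β0 t +
      p.transformed.β1 t * v.normθ p t.castSucc ω + p.transformed.β2 t * v.logY t ω)) μ ∧
    μ[fun ω => v.normI p t ω - (p.transformed.β0 t +
      p.transformed.β1 t * v.normθ p t.castSucc ω + p.transformed.β2 t * v.logY t ω) |
      MeasurableSpace.comap (fun ω => (v.normθ p t.castSucc ω, v.logY t ω)) inferInstance]
      =ᵐ[μ] 0 := by
  have hres : (fun ω => v.normI p t ω - (p.transformed.β0 t +
      p.transformed.β1 t * v.normθ p t.castSucc ω + p.transformed.β2 t * v.logY t ω)) =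
      fun ω => p.lamI t 0 * v.ηI t ω := by
    funext ω
    rw [heq.normI_eq hp t ω]
    ring
  have hσ : MeasurableSpace.comap (fun ω => (v.θ t.castSucc ω, v.Y t ω)) inferInstance =
      MeasurableSpace.comap (fun ω => (v.normθ p t.castSucc ω, v.logY t ω)) inferInstance := by
    refine comap_eq_comap_of_comp
      (F := fun x : ℝ × ℝ => (p.muθ t.castSucc 0 + p.lamθ t.castSucc 0 * Real.log x.1,
        Real.log x.2))
      (G := fun x : ℝ × ℝ => (Real.exp ((x.1 - p.muθ t.castSucc 0) / p.lamθ t.castSucc 0),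
        Real.exp x.2)) (by fun_prop) (by fun_prop) (fun ω => rfl) fun ω => ?_
    simp only [SkillVars.normθ, add_sub_cancel_left, mul_div_cancel_left₀ _ (hp.lamθ_ne _ 0),
      v.exp_logθ, v.exp_logY]
  rw [hres, ← hσ]
  exact ⟨(hA.integrable_ηI t).const_mul _, condExp_const_mul_eq_zero _ (hA.ηI_mean t)⟩

/-- With a control function, the rewritten production technology is a regression equation. -/
theorem production_regression (hA : BaselineAssumption v μ) (heq : v.Equations p)
    (hp : p.Admissible) (t : Fin T) : ∃ k : ℝ,
    Integrable (fun ω => v.normθ p t.succ ω -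
      (p.transformed.logCES t (v.normθ p t.castSucc ω) (v.normI p t ω) +
        k * (v.normI p t ω - p.transformed.β0 t - p.transformed.β1 t * v.normθ p t.castSucc ω
          - p.transformed.β2 t * v.logY t ω))) μ ∧
    μ[fun ω => v.normθ p t.succ ω -
      (p.transformed.logCES t (v.normθ p t.castSucc ω) (v.normI p t ω) +
        k * (v.normI p t ω - p.transformed.β0 t - p.transformed.β1 t * v.normθ p t.castSucc ω
          - p.transformed.β2 t * v.logY t ω)) |
      MeasurableSpace.comap (fun ω => (v.normθ p t.castSucc ω, v.normI p t ω, v.logY t ω))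
        inferInstance] =ᵐ[μ] 0 := by
  obtain ⟨κ, hκ⟩ := hA.ηθ_control
  have hlI := hp.lamI_ne t 0
  -- The control coefficient in normalised units: the production shock scales with the loading at `t
  -- + 1`, the investment shock with the investment loading.
  refine ⟨p.lamθ t.succ 0 * κ t / p.lamI t 0, ?_⟩
  have hres : (fun ω => v.normθ p t.succ ω -
      (p.transformed.logCES t (v.normθ p t.castSucc ω) (v.normI p t ω) +
        p.lamθ t.succ 0 * κ t / p.lamI t 0 *
          (v.normI p t ω - p.transformed.β0 t - p.transformed.β1 t * v.normθ p t.castSucc ω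
          - p.transformed.β2 t * v.logY t ω))) =
      fun ω => p.lamθ t.succ 0 * (v.ηθ t ω - κ t * v.ηI t ω) := by
    funext ω
    have h1 : v.normI p t ω - p.transformed.β0 t -
        p.transformed.β1 t * v.normθ p t.castSucc ω - p.transformed.β2 t * v.logY t ω =
        p.lamI t 0 * v.ηI t ω := by
      rw [heq.normI_eq hp t ω]
      ring
    rw [h1, heq.normθ_succ_eq hp t ω]
    field_simp
    ring
  -- Given skill and income, the investment equation makes the shock and investment functions of
  -- each other.
  have hσ : MeasurableSpace.comap (fun ω => (v.θ t.castSucc ω, v.ηI t ω, v.Y t ω))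
        inferInstance =
      MeasurableSpace.comap (fun ω => (v.normθ p t.castSucc ω, v.normI p t ω, v.logY t ω))
        inferInstance := by
    refine comap_eq_comap_of_comp
      (F := fun x : ℝ × ℝ × ℝ => (p.muθ t.castSucc 0 + p.lamθ t.castSucc 0 * Real.log x.1,
        p.transformed.β0 t + p.transformed.β1 t *
          (p.muθ t.castSucc 0 + p.lamθ t.castSucc 0 * Real.log x.1) +
          p.transformed.β2 t * Real.log x.2.2 + p.lamI t 0 * x.2.1, Real.log x.2.2))
      (G := fun x : ℝ × ℝ × ℝ =>
        (Real.exp ((x.1 - p.muθ t.castSucc 0) / p.lamθ t.castSucc 0),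
        (x.2.1 - (p.transformed.β0 t + p.transformed.β1 t * x.1 + p.transformed.β2 t * x.2.2)) /
          p.lamI t 0, Real.exp x.2.2)) (by fun_prop) (by fun_prop) (fun ω => ?_) fun ω => ?_
    · rw [heq.normI_eq hp t ω]
      rfl
    · simp only
      rw [heq.normI_eq hp t ω, add_sub_cancel_left, mul_div_cancel_left₀ _ hlI]
      simp only [SkillVars.normθ, add_sub_cancel_left, mul_div_cancel_left₀ _ (hp.lamθ_ne _ 0),
        v.exp_logθ, v.exp_logY]
  have hint : Integrable (fun ω => κ t * v.ηI t ω) μ := (hA.integrable_ηI t).const_mul _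
  have hm : Measurable fun ω => (v.θ t.castSucc ω, v.ηI t ω, v.Y t ω) :=
    (v.measurable_θ _).prodMk ((v.measurable_ηI t).prodMk (v.measurable_Y t))
  rw [hres, ← hσ]
  refine ⟨((hA.integrable_ηθ t).sub hint).const_mul _, condExp_const_mul_eq_zero _ ?_⟩
  have h2 : Measurable fun x : ℝ × ℝ × ℝ => κ t * x.2.1 := by fun_prop
  exact condExp_sub_eq_zero hm.comap_le (hA.integrable_ηθ t) hint
    (h2.comp (comap_measurable fun ω =>
      (v.θ t.castSucc ω, v.ηI t ω, v.Y t ω))).stronglyMeasurable (hκ t)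

variable {Ω' : Type} [MeasurableSpace Ω'] [StandardBorelSpace Ω'] {μ' : Measure Ω'}
  [IsProbabilityMeasure μ'] {v' : SkillVars T Ω'} {p' : CESParams T}

/-- Observationally equivalent structures have the same transformed parameters. -/
theorem transformed_eq (hA : BaselineAssumption v μ) (hA' : BaselineAssumption v' μ')
    (heq : v.Equations p) (heq' : v'.Equations p') (hp : p.Admissible) (hp' : p'.Admissible)
    (hobs : μ.map (v.observed p) = μ'.map (v'.observed p')) :
    p.transformed = p'.transformed := by
  obtain ⟨hmuθ, hlamθ, hmuI, hlamI, hρ0, hρ1⟩ := hA.measurement_eq hA' hp hp' hobs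
  have hlaw := normLatent_law_eq hp hp' hA hA' hobs
    (by simp only [CESTransformed.intercept, hmuθ, hmuI])
    (by simp only [CESTransformed.loading, hlamθ, hlamI])
  have htr : ∀ {E : Type} [MeasurableSpace E] (f : (Fin T → ℝ) × (LatIdx T → ℝ) → E),
      Measurable f → μ.map (fun ω => f (v.income ω, v.normLatent p ω)) =
        μ'.map (fun ω => f (v'.income ω, v'.normLatent p' ω)) := by
    intro E _ f hf
    have := congrArg (Measure.map f) hlaw
    rwa [Measure.map_map hf (v.measurable_income.prodMk (v.measurable_normLatent p)),
      Measure.map_map hf (v'.measurable_income.prodMk (v'.measurable_normLatent p'))] at this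
  have hβ : ∀ t, p.transformed.β0 t = p'.transformed.β0 t ∧
      p.transformed.β1 t = p'.transformed.β1 t ∧ p.transformed.β2 t = p'.transformed.β2 t := by
    intro t
    obtain ⟨i1, r1⟩ := hA.investment_regression heq hp t
    obtain ⟨i2, r2⟩ := hA'.investment_regression heq' hp' t
    have h1 := regression_ae_eq
      (U := fun ω => (v.normθ p t.castSucc ω, v.logY t ω))
      (U' := fun ω => (v'.normθ p' t.castSucc ω, v'.logY t ω))
      (g := fun x : ℝ × ℝ => p.transformed.β0 t + p.transformed.β1 t * x.1 +
        p.transformed.β2 t * x.2)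
      (g' := fun x : ℝ × ℝ => p'.transformed.β0 t + p'.transformed.β1 t * x.1 +
        p'.transformed.β2 t * x.2)
      ((v.measurable_normθ p _).prodMk (v.measurable_logY t))
      ((v'.measurable_normθ p' _).prodMk (v'.measurable_logY t))
      (v.measurable_normI p t) (v'.measurable_normI p' t) (by fun_prop) (by fun_prop)
      (hA.integrable_normI p t) (hA'.integrable_normI p' t) i1 i2 r1 r2
      (htr (fun x => ((x.2 (.inl t.castSucc), Real.log (x.1 t)), x.2 (.inr t))) (by fun_prop))
    -- The support condition upgrades almost sure equality of the regression functions to equality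
    -- on an open set, which separates the coefficients.
    obtain ⟨w, hw⟩ := hA.exists_eventually_eq_zero t (hp.lamθ_ne t.castSucc 0) (hp.lamI_ne t 0)
      (a := p.muθ t.castSucc 0) (a' := p.muI t 0)
      (D := fun x => (p.transformed.β0 t - p'.transformed.β0 t) +
        (p.transformed.β1 t - p'.transformed.β1 t) * x.1 +
        (p.transformed.β2 t - p'.transformed.β2 t) * x.2.2) (by fun_prop) (by
          filter_upwards [h1] with ω h1
          simp only [SkillVars.normθ] at h1
          linear_combination h1)
    obtain ⟨e0, e1, e2⟩ := affine_eq_zero_of_eventually hw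
    exact ⟨sub_eq_zero.1 e0, sub_eq_zero.1 e1, sub_eq_zero.1 e2⟩
  have hγ : ∀ t, p'.transformed.expOut t = p.transformed.expOut t ∧
      p'.transformed.expθ t = p.transformed.expθ t ∧
      p'.transformed.expI t = p.transformed.expI t ∧
      p'.transformed.γ1 t = p.transformed.γ1 t ∧ p'.transformed.γ2 t = p.transformed.γ2 t := by
    intro t
    obtain ⟨k, i1, r1⟩ := hA.production_regression heq hp t
    obtain ⟨k', i2, r2⟩ := hA'.production_regression heq' hp' t
    have hc : ∀ (p : CESParams T), p.Admissible → Continuous fun x : ℝ × ℝ × ℝ =>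
        p.transformed.logCES t x.1 x.2.1 := by
      intro p hp
      have h1 : 0 < p.transformed.γ1 t := mul_pos (hp.γ1_pos t) (Real.exp_pos _)
      have h2 : 0 < p.transformed.γ2 t := mul_pos (hp.γ2_pos t) (Real.exp_pos _)
      exact continuous_const.mul (Continuous.log (by fun_prop) fun x => by positivity)
    have hcg : ∀ (p : CESParams T) (k : ℝ), p.Admissible → Continuous fun x : ℝ × ℝ × ℝ =>
        p.transformed.logCES t x.1 x.2.1 + k * (x.2.1 - p.transformed.β0 t -
          p.transformed.β1 t * x.1 - p.transformed.β2 t * x.2.2) :=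
      fun p k hp => (hc p hp).add (by fun_prop)
    have h1 := regression_ae_eq
      (U := fun ω => (v.normθ p t.castSucc ω, v.normI p t ω, v.logY t ω))
      (U' := fun ω => (v'.normθ p' t.castSucc ω, v'.normI p' t ω, v'.logY t ω))
      ((v.measurable_normθ p _).prodMk ((v.measurable_normI p t).prodMk (v.measurable_logY t)))
      ((v'.measurable_normθ p' _).prodMk
        ((v'.measurable_normI p' t).prodMk (v'.measurable_logY t)))
      (v.measurable_normθ p t.succ) (v'.measurable_normθ p' t.succ)
      (hcg p k hp).measurable (hcg p' k' hp').measurable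
      (hA.integrable_normθ p _) (hA'.integrable_normθ p' _) i1 i2 r1 r2
      (htr (fun x => ((x.2 (.inl t.castSucc), x.2 (.inr t), Real.log (x.1 t)),
        x.2 (.inl t.succ))) (by fun_prop))
    obtain ⟨w, hw⟩ := hA.exists_eventually_eq_zero t (hp.lamθ_ne t.castSucc 0) (hp.lamI_ne t 0)
      (a := p.muθ t.castSucc 0) (a' := p.muI t 0) ((hcg p k hp).sub (hcg p' k' hp')) (by
          filter_upwards [h1] with ω h1
          exact sub_eq_zero.2 h1)
    have hne : ∀ (p : CESParams T), p.Admissible → p.transformed.expOut t ≠ 0 ∧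
        p.transformed.expθ t ≠ 0 ∧ p.transformed.expI t ≠ 0 := fun p hp =>
      ⟨div_ne_zero (mul_ne_zero (hp.lamθ_ne _ 0) (hp.ψ_ne t)) (hp.σ_ne t),
        div_ne_zero (hp.σ_ne t) (hp.lamθ_ne _ 0), div_ne_zero (hp.σ_ne t) (hp.lamI_ne _ 0)⟩
    -- The control coefficients are not yet known to agree. As the investment coefficients do, the
    -- discrepancy is `k' - k` times a common residual.
    refine ces_unique (w := w) (k := k' - k) (β₀ := p.transformed.β0 t)
      (β₁ := p.transformed.β1 t) (β₂ := p.transformed.β2 t) (hne p hp).1 (hne p hp).2.1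
      (hne p' hp').2.1 (hne p hp).2.2
      (mul_pos (hp.γ1_pos t) (Real.exp_pos _)) (mul_pos (hp'.γ1_pos t) (Real.exp_pos _))
      (mul_pos (hp.γ2_pos t) (Real.exp_pos _)) (mul_pos (hp'.γ2_pos t) (Real.exp_pos _)) ?_ ?_
    -- In primitive units the knife-edge relation between the transformed exponents reads `β1 = -1`.
    · intro h2 h3
      have hβ2 : p.β2 t = 0 := (mul_eq_zero.1 h2).resolve_left (hp.lamI_ne t 0)
      refine hp.relevance t hβ2 ?_
      have l1 := hp.lamI_ne t 0
      have l2 := hp.lamθ_ne t.castSucc 0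
      have l3 := hp.σ_ne t
      simp only [CESParams.transformed] at h3
      field_simp at h3
      linarith
    · filter_upwards [hw] with x hx
      simp only [CESTransformed.logCES, Pi.sub_apply] at hx
      obtain ⟨e0, e1, e2⟩ := hβ t
      rw [← e0, ← e1, ← e2] at hx
      linear_combination hx
  ext1
  · exact hmuθ
  · exact hlamθ
  · exact hmuI
  · exact hlamI
  · exact hρ0
  · exact hρ1
  · exact funext fun t => (hβ t).1
  · exact funext fun t => (hβ t).2.1
  · exact funext fun t => (hβ t).2.2
  · exact funext fun t => (hγ t).2.2.2.1.symm
  · exact funext fun t => (hγ t).2.2.2.2.symm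
  · exact funext fun t => (hγ t).2.1.symm
  · exact funext fun t => (hγ t).2.2.1.symm
  · exact funext fun t => (hγ t).1.symm

end BaselineAssumption

-- Equal transformed parameters imply observational equivalence.

/-- The change of units that turns a latent variable whose first measure has intercept `a` and
loading `b` into one whose first measure has intercept `a'` and loading `b'`. -/
noncomputable def changeUnits (a b a' b' x : ℝ) : ℝ := Real.exp ((a + b * Real.log x - a') / b')

theorem measurable_changeUnits (a b a' b' : ℝ) : Measurable (changeUnits a b a' b') := by
  unfold changeUnits
  fun_prop

theorem changeUnits_pos (a b a' b' x : ℝ) : 0 < changeUnits a b a' b' x := Real.exp_pos _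

theorem log_changeUnits (a b a' b' x : ℝ) :
    Real.log (changeUnits a b a' b' x) = (a + b * Real.log x - a') / b' := Real.log_exp _

theorem changeUnits_changeUnits {a b a' b' x : ℝ} (hb : b ≠ 0) (hb' : b' ≠ 0) (hx : 0 < x) :
    changeUnits a' b' a b (changeUnits a b a' b' x) = x := by
  rw [changeUnits, log_changeUnits, mul_div_cancel₀ _ hb', add_sub_cancel, add_sub_cancel_left,
    mul_div_cancel_left₀ _ hb, Real.exp_log hx]

theorem continuousAt_changeUnits (a b a' b' : ℝ) {x : ℝ} (hx : 0 < x) :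
    ContinuousAt (changeUnits a b a' b') x := by
  have := Real.continuousAt_log hx.ne'
  unfold changeUnits
  fun_prop

namespace SkillVars

variable {T : ℕ} {Ω : Type} [MeasurableSpace Ω]

/-- The random variables of the model with the latent variables in new units. -/
noncomputable def rescale (v : SkillVars T Ω) (p p' : CESParams T) : SkillVars T Ω where
  θ t ω := changeUnits (p.muθ t 0) (p.lamθ t 0) (p'.muθ t 0) (p'.lamθ t 0) (v.θ t ω)
  inv t ω := changeUnits (p.muI t 0) (p.lamI t 0) (p'.muI t 0) (p'.lamI t 0) (v.inv t ω)
  Y := v.Y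
  εθ := v.εθ
  εI := v.εI
  ηQ := v.ηQ
  -- The production shock is in the units of log skill at `t + 1`, hence the index `t.succ`.
  ηθ t ω := p.lamθ t.succ 0 / p'.lamθ t.succ 0 * v.ηθ t ω
  ηI t ω := p.lamI t 0 / p'.lamI t 0 * v.ηI t ω
  measurable_θ t := (measurable_changeUnits _ _ _ _).comp (v.measurable_θ t)
  measurable_inv t := (measurable_changeUnits _ _ _ _).comp (v.measurable_inv t)
  measurable_Y := v.measurable_Y
  measurable_εθ := v.measurable_εθ
  measurable_εI := v.measurable_εI
  measurable_ηQ := v.measurable_ηQ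
  measurable_ηθ t := (v.measurable_ηθ t).const_mul _
  measurable_ηI t := (v.measurable_ηI t).const_mul _
  θ_pos _ _ := changeUnits_pos _ _ _ _ _
  inv_pos _ _ := changeUnits_pos _ _ _ _ _
  Y_pos := v.Y_pos

variable (v : SkillVars T Ω) (p p' : CESParams T)

theorem rescale_err : (v.rescale p p').err = v.err := by
  funext i
  rcases i with ⟨t, m⟩ | ⟨t, m⟩ | _ <;> rfl

theorem rescale_logθ (t : Fin (T + 1)) (ω : Ω) :
    (v.rescale p p').logθ t ω = (v.normθ p t ω - p'.muθ t 0) / p'.lamθ t 0 :=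
  log_changeUnits _ _ _ _ _

theorem rescale_logI (t : Fin T) (ω : Ω) :
    (v.rescale p p').logI t ω = (v.normI p t ω - p'.muI t 0) / p'.lamI t 0 :=
  log_changeUnits _ _ _ _ _

theorem rescale_logθ_affine (t : Fin (T + 1)) :
    (v.rescale p p').logθ t = fun ω => (p.muθ t 0 - p'.muθ t 0) / p'.lamθ t 0 +
      p.lamθ t 0 / p'.lamθ t 0 * v.logθ t ω := by
  funext ω
  rw [rescale_logθ, normθ]
  ring

theorem rescale_logI_affine (t : Fin T) :
    (v.rescale p p').logI t = fun ω => (p.muI t 0 - p'.muI t 0) / p'.lamI t 0 +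
      p.lamI t 0 / p'.lamI t 0 * v.logI t ω := by
  funext ω
  rw [rescale_logI, normI]
  ring

variable {v p p'}

theorem rescale_observed (hp : p.Admissible) (hp' : p'.Admissible)
    (h : p'.transformed = p.transformed) : (v.rescale p p').observed p' = v.observed p := by
  have affine : ∀ {a b a₀ b₀ a' b' a₀' b₀' x : ℝ}, b₀ ≠ 0 → b₀' ≠ 0 →
      a' - b' / b₀' * a₀' = a - b / b₀ * a₀ → b' / b₀' = b / b₀ →
      a' + b' * ((a₀ + b₀ * x - a₀') / b₀') = a + b * x := by
    intro a b a₀ b₀ a' b' a₀' b₀' x hb hb' h1 h2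
    calc a' + b' * ((a₀ + b₀ * x - a₀') / b₀')
        = (a' - b' / b₀' * a₀') + b' / b₀' * (a₀ + b₀ * x) := by ring
      _ = a + b * x := by rw [h1, h2]; field_simp; ring
  funext ω
  simp only [observed, rescale_logθ, rescale_logI, normθ, normI]
  refine Prod.ext ?_ (Prod.ext ?_ (Prod.ext rfl ?_))
  · funext t m
    exact congrArg (· + v.εθ t m ω) (affine (hp.lamθ_ne t 0) (hp'.lamθ_ne t 0)
      (congrFun (congrFun (congrArg CESTransformed.muθ h) t) m)
      (congrFun (congrFun (congrArg CESTransformed.lamθ h) t) m))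
  · funext t m
    exact congrArg (· + v.εI t m ω) (affine (hp.lamI_ne t 0) (hp'.lamI_ne t 0)
      (congrFun (congrFun (congrArg CESTransformed.muI h) t) m)
      (congrFun (congrFun (congrArg CESTransformed.lamI h) t) m))
  · have h0 := congrArg CESTransformed.ρ0 h
    simp only [CESParams.transformed, mul_div_right_comm] at h0
    exact congrArg (· + v.ηQ ω) (affine (hp.lamθ_ne _ 0) (hp'.lamθ_ne _ 0) h0
      (congrArg CESTransformed.ρ1 h))

/-- The normalised logs of the rescaled variables under `p'` are those of the original ones under
`p`, so both systems reduce to the same normalised equations. -/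
theorem rescale_equations (hp : p.Admissible) (hp' : p'.Admissible)
    (h : p'.transformed = p.transformed) (heq : v.Equations p) :
    (v.rescale p p').Equations p' := by
  refine ⟨fun t ω => ?_, fun t ω => ?_⟩
  · have hl := hp'.lamθ_ne t.succ 0
    have hS := hp'.ces_pos t ((v.rescale p p').logθ t.castSucc ω) ((v.rescale p p').logI t ω)
    rw [(v.rescale p p').rpow_θ, (v.rescale p p').rpow_inv, Real.rpow_def_of_pos hS,
      ← Real.exp_add, ← exp_logθ]
    congr 1
    have h1 := hp'.logCES_eq t ((v.rescale p p').logθ t.castSucc ω) ((v.rescale p p').logI t ω)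
    have h2 := heq.normθ_succ_eq hp t ω
    rw [rescale_logθ, rescale_logI, mul_div_cancel₀ _ (hp'.lamθ_ne t.castSucc 0),
      mul_div_cancel₀ _ (hp'.lamI_ne t 0), add_sub_cancel, add_sub_cancel, h,
      ← rescale_logθ, ← rescale_logI] at h1
    rw [h1] at h2
    rw [rescale_logθ _ _ _ t.succ, h2]
    change _ = _ + p.lamθ t.succ 0 / p'.lamθ t.succ 0 * v.ηθ t ω
    field_simp
    ring
  · have hlI := hp'.lamI_ne t 0
    have hlθ := hp'.lamθ_ne t.castSucc 0
    have h2 := heq.normI_eq hp t ω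
    rw [← h] at h2
    rw [rescale_logI, h2, rescale_logθ]
    change _ = _ + p'.β2 t * v.logY t ω + p.lamI t 0 / p'.lamI t 0 * v.ηI t ω
    simp only [CESParams.transformed]
    field_simp
    ring

end SkillVars

theorem memLp_affine {Ω : Type*} [MeasurableSpace Ω] {μ : Measure Ω} [IsFiniteMeasure μ]
    {f : Ω → ℝ} (hf : MemLp f 2 μ) (c d : ℝ) : MemLp (fun ω => c + d * f ω) 2 μ :=
  (memLp_const c).add (hf.const_mul d)

theorem covariance_affine_ne_zero {Ω : Type*} [MeasurableSpace Ω] {μ : Measure Ω}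
    [IsProbabilityMeasure μ] {f g : Ω → ℝ} (hf : MemLp f 2 μ) (hg : MemLp g 2 μ)
    {c d c' d' : ℝ} (hd : d ≠ 0) (hd' : d' ≠ 0) (h : covariance f g μ ≠ 0) :
    covariance (fun ω => c + d * f ω) (fun ω => c' + d' * g ω) μ ≠ 0 := by
  rw [covariance_const_add_left ((hf.const_mul d).integrable one_le_two),
    covariance_const_add_right ((hg.const_mul d').integrable one_le_two),
    covariance_const_mul_left, covariance_const_mul_right]
  exact mul_ne_zero hd (mul_ne_zero hd' h)

namespace BaselineAssumption

variable {T : ℕ} {Ω : Type} [MeasurableSpace Ω] [StandardBorelSpace Ω] {μ : Measure Ω}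
  [IsProbabilityMeasure μ] {v : SkillVars T Ω} {p p' : CESParams T}

/-- On the positive orthant the change of units is continuous with continuous inverse, so it
preserves open sets all of whose points lie in the support. -/
theorem rescale_support_ball (hA : BaselineAssumption v μ) (hp : p.Admissible)
    (hp' : p'.Admissible) (t : Fin T) : ∃ c : ℝ × ℝ × ℝ, ∃ r > 0, Metric.ball c r ⊆
      (μ.map (fun ω => ((v.rescale p p').θ t.castSucc ω, (v.rescale p p').inv t ω,
        (v.rescale p p').Y t ω))).support := by
  obtain ⟨V, hV, ⟨x₀, hx₀⟩, hVpos, hVm⟩ := hA.exists_open_support t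
  set conv : CESParams T → CESParams T → ℝ × ℝ × ℝ → ℝ × ℝ × ℝ := fun p p' x =>
    (changeUnits (p.muθ t.castSucc 0) (p.lamθ t.castSucc 0) (p'.muθ t.castSucc 0)
      (p'.lamθ t.castSucc 0) x.1,
     changeUnits (p.muI t 0) (p.lamI t 0) (p'.muI t 0) (p'.lamI t 0) x.2.1, x.2.2) with hconv
  have hinv : ∀ {p p' : CESParams T}, p.Admissible → p'.Admissible → ∀ x : ℝ × ℝ × ℝ,
      0 < x.1 → 0 < x.2.1 → conv p' p (conv p p' x) = x := by
    intro p p' hp hp' x h1 h2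
    simp only [hconv]
    rw [changeUnits_changeUnits (hp.lamθ_ne _ 0) (hp'.lamθ_ne _ 0) h1,
      changeUnits_changeUnits (hp.lamI_ne _ 0) (hp'.lamI_ne _ 0) h2]
  have hcont : ∀ (p p' : CESParams T) (x : ℝ × ℝ × ℝ), 0 < x.1 → 0 < x.2.1 →
      ContinuousAt (conv p p') x := by
    intro p p' x h1 h2
    exact ((continuousAt_changeUnits _ _ _ _ h1).comp continuousAt_fst).prodMk
      (((continuousAt_changeUnits _ _ _ _ h2).comp
        (f := fun x : ℝ × ℝ × ℝ => x.2.1) (by fun_prop)).prodMk (by fun_prop))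
  have hmeas : Measurable fun ω => ((v.rescale p p').θ t.castSucc ω, (v.rescale p p').inv t ω,
      (v.rescale p p').Y t ω) :=
    ((v.rescale p p').measurable_θ _).prodMk
      (((v.rescale p p').measurable_inv t).prodMk ((v.rescale p p').measurable_Y t))
  have hpos := hVpos x₀ hx₀
  have hnhds : ∀ᶠ y in 𝓝 (conv p p' x₀), 0 < y.1 ∧ 0 < y.2.1 ∧ conv p' p y ∈ V := by
    have h1 : 0 < (conv p p' x₀).1 := changeUnits_pos _ _ _ _ _
    have h2 : 0 < (conv p p' x₀).2.1 := changeUnits_pos _ _ _ _ _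
    refine (continuousAt_fst.eventually (lt_mem_nhds h1)).and
      (((by fun_prop : ContinuousAt (fun y : ℝ × ℝ × ℝ => y.2.1) (conv p p' x₀)).eventually
        (lt_mem_nhds h2)).and ((hcont p' p _ h1 h2).eventually (hV.mem_nhds ?_)))
    rwa [hinv hp hp' x₀ hpos.1 hpos.2.1]
  obtain ⟨r, hr, hball⟩ := Metric.eventually_nhds_iff_ball.1 hnhds
  refine ⟨conv p p' x₀, r, hr, fun y hy => (Measure.mem_support_iff_forall _).2 fun N hN => ?_⟩
  obtain ⟨h1, h2, h3⟩ := hball y hy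
  obtain ⟨N', hN', ho, hyN⟩ := mem_nhds_iff.1 hN
  refine lt_of_lt_of_le ?_ (measure_mono hN')
  rw [Measure.map_apply hmeas ho.measurableSet]
  have hq := hVpos _ h3
  have hpre : conv p p' ⁻¹' N' ∈ 𝓝 (conv p' p y) :=
    (hcont p p' _ hq.1 hq.2.1).preimage_mem_nhds
      (ho.mem_nhds (by rwa [hinv hp' hp y h1 h2]))
  exact hVm _ h3 _ hpre

/-- Errors and income stay untouched. Logs change affinely with nonzero slope, which preserves
moments and nonzero covariances, and the conditioning σ-algebras stay the same. -/
theorem rescale (hA : BaselineAssumption v μ) (hp : p.Admissible) (hp' : p'.Admissible) :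
    BaselineAssumption (v.rescale p p') μ := by
  have hθd : ∀ t, p.lamθ t 0 / p'.lamθ t 0 ≠ 0 := fun t =>
    div_ne_zero (hp.lamθ_ne t 0) (hp'.lamθ_ne t 0)
  have hId : ∀ t, p.lamI t 0 / p'.lamI t 0 ≠ 0 := fun t =>
    div_ne_zero (hp.lamI_ne t 0) (hp'.lamI_ne t 0)
  have hσ : ∀ t : Fin T,
      MeasurableSpace.comap (fun ω => (v.θ t.castSucc ω, v.Y t ω)) inferInstance =
      MeasurableSpace.comap (fun ω => ((v.rescale p p').θ t.castSucc ω, (v.rescale p p').Y t ω))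
        inferInstance := by
    intro t
    refine comap_eq_comap_of_comp
      (F := fun x : ℝ × ℝ => (changeUnits (p.muθ t.castSucc 0) (p.lamθ t.castSucc 0)
        (p'.muθ t.castSucc 0) (p'.lamθ t.castSucc 0) x.1, x.2))
      (G := fun x : ℝ × ℝ => (changeUnits (p'.muθ t.castSucc 0) (p'.lamθ t.castSucc 0)
        (p.muθ t.castSucc 0) (p.lamθ t.castSucc 0) x.1, x.2))
      (((measurable_changeUnits _ _ _ _).comp measurable_fst).prodMk measurable_snd)
      (((measurable_changeUnits _ _ _ _).comp measurable_fst).prodMk measurable_snd)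
      (fun ω => rfl) fun ω => ?_
    exact Prod.ext
      (changeUnits_changeUnits (hp.lamθ_ne _ 0) (hp'.lamθ_ne _ 0) (v.θ_pos _ _)).symm rfl
  have hσ' : ∀ t : Fin T,
      MeasurableSpace.comap (fun ω => (v.θ t.castSucc ω, v.ηI t ω, v.Y t ω)) inferInstance =
      MeasurableSpace.comap (fun ω => ((v.rescale p p').θ t.castSucc ω,
        (v.rescale p p').ηI t ω, (v.rescale p p').Y t ω)) inferInstance := by
    intro t
    refine comap_eq_comap_of_comp
      (F := fun x : ℝ × ℝ × ℝ => (changeUnits (p.muθ t.castSucc 0) (p.lamθ t.castSucc 0)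
        (p'.muθ t.castSucc 0) (p'.lamθ t.castSucc 0) x.1,
          p.lamI t 0 / p'.lamI t 0 * x.2.1, x.2.2))
      (G := fun x : ℝ × ℝ × ℝ => (changeUnits (p'.muθ t.castSucc 0) (p'.lamθ t.castSucc 0)
        (p.muθ t.castSucc 0) (p.lamθ t.castSucc 0) x.1,
          x.2.1 / (p.lamI t 0 / p'.lamI t 0), x.2.2))
      (((measurable_changeUnits _ _ _ _).comp measurable_fst).prodMk (by fun_prop))
      (((measurable_changeUnits _ _ _ _).comp measurable_fst).prodMk (by fun_prop))
      (fun ω => rfl) fun ω => ?_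
    exact Prod.ext
      (changeUnits_changeUnits (hp.lamθ_ne _ 0) (hp'.lamθ_ne _ 0) (v.θ_pos _ _)).symm
      (Prod.ext (mul_div_cancel_left₀ _ (hId t)).symm rfl)
  refine
    { err_indep := ?_
      err_latent_indep := ?_
      memLp_logθ := fun t => ?_
      memLp_logI := fun t => ?_
      memLp_logY := hA.memLp_logY
      memLp_err := fun i => ?_
      memLp_ηθ := fun t => (hA.memLp_ηθ t).const_mul _
      memLp_ηI := fun t => (hA.memLp_ηI t).const_mul _
      err_mean := fun i => ?_
      cov_θ := fun t => ?_
      cov_I := fun t => ?_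
      err_charFun := fun i => ?_
      support_ball := hA.rescale_support_ball hp hp'
      ηθ_mean := fun t => ?_
      ηθ_control := ?_
      ηI_mean := fun t => ?_ }
  · rw [v.rescale_err p p']
    exact hA.err_indep
  · rw [v.rescale_err p p']
    have hφ : Measurable fun x : (Fin (T + 1) → ℝ) × (Fin T → ℝ) =>
        (((fun t => changeUnits (p.muθ t 0) (p.lamθ t 0) (p'.muθ t 0) (p'.lamθ t 0) (x.1 t)),
        (fun t => changeUnits (p.muI t 0) (p.lamI t 0) (p'.muI t 0) (p'.lamI t 0) (x.2 t))) :
          (Fin (T + 1) → ℝ) × (Fin T → ℝ)) :=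
      (measurable_pi_lambda _ fun t => (measurable_changeUnits _ _ _ _).comp
        ((measurable_pi_apply t).comp measurable_fst)).prodMk
      (measurable_pi_lambda _ fun t => (measurable_changeUnits _ _ _ _).comp
        ((measurable_pi_apply t).comp measurable_snd))
    exact hA.err_latent_indep.comp measurable_id hφ
  · rw [v.rescale_logθ_affine p p']
    exact memLp_affine (hA.memLp_logθ t) _ _
  · rw [v.rescale_logI_affine p p']
    exact memLp_affine (hA.memLp_logI t) _ _
  · rw [v.rescale_err p p']
    exact hA.memLp_err i
  · rw [v.rescale_err p p']
    exact hA.err_mean i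
  · simp only [v.rescale_logθ_affine p p', v.rescale_logI_affine p p']
    rcases hA.cov_θ t with ⟨s, hs⟩ | ⟨s, hst, hs⟩
    · exact Or.inl ⟨s, covariance_affine_ne_zero (hA.memLp_logθ t) (hA.memLp_logI s)
        (hθd t) (hId s) hs⟩
    · exact Or.inr ⟨s, hst, covariance_affine_ne_zero (hA.memLp_logθ t) (hA.memLp_logθ s)
        (hθd t) (hθd s) hs⟩
  · simp only [v.rescale_logθ_affine p p', v.rescale_logI_affine p p']
    rcases hA.cov_I t with ⟨s, hs⟩ | ⟨s, hst, hs⟩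
    · exact Or.inl ⟨s, covariance_affine_ne_zero (hA.memLp_logI t) (hA.memLp_logθ s)
        (hId t) (hθd s) hs⟩
    · exact Or.inr ⟨s, hst, covariance_affine_ne_zero (hA.memLp_logI t) (hA.memLp_logI s)
        (hId t) (hId s) hs⟩
  · rw [v.rescale_err p p']
    exact hA.err_charFun i
  · rw [← hσ t]
    exact condExp_const_mul_eq_zero _ (hA.ηθ_mean t)
  · obtain ⟨κ, hκ⟩ := hA.ηθ_control
    -- The control coefficient absorbs the ratio of the scalings of the two shocks.
    refine ⟨fun t => p.lamθ t.succ 0 / p'.lamθ t.succ 0 * κ t / (p.lamI t 0 / p'.lamI t 0),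
      fun t => ?_⟩
    rw [← hσ' t]
    set d := p.lamθ t.succ 0 / p'.lamθ t.succ 0
    have h1 := condExp_smul (μ := μ) d (v.ηθ t)
      (MeasurableSpace.comap (fun ω => (v.θ t.castSucc ω, v.ηI t ω, v.Y t ω)) inferInstance)
    refine EventuallyEq.trans h1 ?_
    filter_upwards [hκ t] with ω h2
    have l1 := hp.lamI_ne t 0
    have l2 := hp'.lamI_ne t 0
    change d * _ = d * κ t / _ * (p.lamI t 0 / p'.lamI t 0 * v.ηI t ω)
    rw [h2]
    field_simp
  · rw [← hσ t]
    exact condExp_const_mul_eq_zero _ (hA.ηI_mean t)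

end BaselineAssumption

-- Inverting the parameter transformation under a normalisation.

/-- The primitive parameters with given intercepts and loadings of the first measures that
yield given transformed parameters. -/
noncomputable def CESTransformed.solve {T : ℕ} (τ : CESTransformed T) (muθbar : Fin (T + 1) → ℝ)
    (muIbar : Fin T → ℝ) (lamθbar : Fin (T + 1) → ℝ) : CESParams T :=
  -- The order matters: the skill loading fixes `σ`, and `σ` then fixes the investment loading and
  -- `ψ`. This is why no investment loading has to be normalised.
  let σ : Fin T → ℝ := fun t => τ.expθ t * lamθbar t.castSucc
  let lamI : Fin T → ℝ := fun t => σ t / τ.expI t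
  let ψ : Fin T → ℝ := fun t => τ.expOut t * σ t / lamθbar t.succ
  let β1 : Fin T → ℝ := fun t => τ.β1 t * lamθbar t.castSucc / lamI t
  { muθ := fun t m => τ.muθ t m + τ.lamθ t m * muθbar t
    lamθ := fun t m => τ.lamθ t m * lamθbar t
    muI := fun t m => τ.muI t m + τ.lamI t m * muIbar t
    lamI := fun t m => τ.lamI t m * lamI t
    ρ0 := τ.ρ0 + τ.ρ1 * muθbar (Fin.last T)
    ρ1 := τ.ρ1 * lamθbar (Fin.last T)
    β0 := fun t => (τ.β0 t - muIbar t +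
      lamI t / lamθbar t.castSucc * muθbar t.castSucc * β1 t) / lamI t
    β1 := β1
    β2 := fun t => τ.β2 t / lamI t
    γ1 := fun t => τ.γ1 t / Real.exp (σ t * (muθbar t.succ / (ψ t * lamθbar t.succ) -
      muθbar t.castSucc / lamθbar t.castSucc))
    γ2 := fun t => τ.γ2 t / Real.exp (σ t * (muθbar t.succ / (ψ t * lamθbar t.succ) -
      muIbar t / lamI t))
    σ := σ
    ψ := ψ }

namespace CESParams.Admissible

variable {T : ℕ} {p : CESParams T}

/-- The uniqueness half of (c). -/
theorem solve_transformed (hp : p.Admissible) :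
    p.transformed.solve (fun t => p.muθ t 0) (fun t => p.muI t 0) (fun t => p.lamθ t 0) = p := by
  have h1 := hp.lamθ_ne
  have h2 := hp.lamI_ne
  have h3 := hp.σ_ne
  have h4 := hp.ψ_ne
  have hσ : ∀ t : Fin T, p.σ t / p.lamθ t.castSucc 0 * p.lamθ t.castSucc 0 = p.σ t :=
    fun t => div_mul_cancel₀ _ (h1 _ 0)
  have hI : ∀ t : Fin T, p.σ t / (p.σ t / p.lamI t 0) = p.lamI t 0 := fun t =>
    div_div_cancel₀ (h3 t)
  have hψ : ∀ t : Fin T, p.lamθ t.succ 0 * p.ψ t / p.σ t * p.σ t / p.lamθ t.succ 0 = p.ψ t :=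
    fun t => by rw [div_mul_cancel₀ _ (h3 t), mul_div_cancel_left₀ _ (h1 _ 0)]
  have hl : p.lamθ (Fin.last T) 0 ≠ 0 := h1 _ 0
  simp only [CESTransformed.solve, transformed, hσ, hI, hψ]
  ext
  · simp only; ring
  · exact div_mul_cancel₀ _ (h1 _ 0)
  · simp only; ring
  · exact div_mul_cancel₀ _ (h2 _ 0)
  · simp only; ring
  · exact div_mul_cancel₀ _ hl
  · have := h1 (Fin.castSucc ‹Fin T›) 0
    have := h2 ‹Fin T› 0
    simp only; field_simp; ring
  · have := h1 (Fin.castSucc ‹Fin T›) 0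
    have := h2 ‹Fin T› 0
    simp only; field_simp
  · have := h2 ‹Fin T› 0
    simp only; field_simp
  · exact mul_div_cancel_right₀ _ (Real.exp_pos _).ne'
  · exact mul_div_cancel_right₀ _ (Real.exp_pos _).ne'
  · rfl
  · rfl

variable {muθbar : Fin (T + 1) → ℝ} {muIbar : Fin T → ℝ} {lamθbar : Fin (T + 1) → ℝ}

/-- The existence half of (c): every normalisation with nonzero skill loadings is attainable. -/
theorem transformed_solve (hp : p.Admissible) (hl : ∀ t, lamθbar t ≠ 0) :
    (p.transformed.solve muθbar muIbar lamθbar).Admissible ∧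
    (p.transformed.solve muθbar muIbar lamθbar).transformed = p.transformed ∧
    (∀ t, (p.transformed.solve muθbar muIbar lamθbar).muθ t 0 = muθbar t) ∧
    (∀ t, (p.transformed.solve muθbar muIbar lamθbar).muI t 0 = muIbar t) ∧
    (∀ t, (p.transformed.solve muθbar muIbar lamθbar).lamθ t 0 = lamθbar t) := by
  set τ := p.transformed with hτ
  have hexpθ : ∀ t, τ.expθ t ≠ 0 := fun t => div_ne_zero (hp.σ_ne t) (hp.lamθ_ne _ 0)
  have hexpI : ∀ t, τ.expI t ≠ 0 := fun t => div_ne_zero (hp.σ_ne t) (hp.lamI_ne _ 0)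
  have hexpO : ∀ t, τ.expOut t ≠ 0 := fun t =>
    div_ne_zero (mul_ne_zero (hp.lamθ_ne _ 0) (hp.ψ_ne t)) (hp.σ_ne t)
  have hlθ : ∀ t, τ.lamθ t 0 = 1 := fun t => div_self (hp.lamθ_ne t 0)
  have hlI : ∀ t, τ.lamI t 0 = 1 := fun t => div_self (hp.lamI_ne t 0)
  have hmθ : ∀ t, τ.muθ t 0 = 0 := fun t => by
    change p.muθ t 0 - p.lamθ t 0 / p.lamθ t 0 * p.muθ t 0 = 0
    rw [div_self (hp.lamθ_ne t 0)]; ring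
  have hmI : ∀ t, τ.muI t 0 = 0 := fun t => by
    change p.muI t 0 - p.lamI t 0 / p.lamI t 0 * p.muI t 0 = 0
    rw [div_self (hp.lamI_ne t 0)]; ring
  have hlast : lamθbar (Fin.last T) ≠ 0 := hl _
  refine ⟨⟨fun t m => ?_, fun t m => ?_, fun t => ?_, fun t => ?_, fun t => ?_, fun t => ?_,
    fun t h => ?_⟩, ?_, fun t => ?_, fun t => ?_, fun t => ?_⟩
  · exact mul_ne_zero (div_ne_zero (hp.lamθ_ne t m) (hp.lamθ_ne t 0)) (hl t)
  · exact mul_ne_zero (div_ne_zero (hp.lamI_ne t m) (hp.lamI_ne t 0))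
      (div_ne_zero (mul_ne_zero (hexpθ t) (hl _)) (hexpI t))
  · exact div_pos (mul_pos (hp.γ1_pos t) (Real.exp_pos _)) (Real.exp_pos _)
  · exact div_pos (mul_pos (hp.γ2_pos t) (Real.exp_pos _)) (Real.exp_pos _)
  · exact mul_ne_zero (hexpθ t) (hl _)
  · exact div_ne_zero (mul_ne_zero (hexpO t) (mul_ne_zero (hexpθ t) (hl _))) (hl _)
  · have h1 := hl t.castSucc
    have h2 := hexpθ t
    have h3 := hexpI t
    have hL : τ.expθ t * lamθbar t.castSucc / τ.expI t ≠ 0 := div_ne_zero (mul_ne_zero h2 h1) h3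
    have hβ2 : p.β2 t = 0 :=
      (mul_eq_zero.1 ((div_eq_zero_iff.1 h).resolve_right hL)).resolve_left (hp.lamI_ne t 0)
    -- The ratio of the skill and investment loadings is preserved, so the skill elasticity of
    -- investment is too, and the knife-edge exclusion carries over.
    have hβ1 : (τ.solve muθbar muIbar lamθbar).β1 t = p.β1 t := by
      have l1 := hp.lamI_ne t 0
      have l2 := hp.lamθ_ne t.castSucc 0
      have l3 := hp.σ_ne t
      simp only [CESTransformed.solve, hτ, CESParams.transformed]
      field_simp
    rw [hβ1]
    exact hp.relevance t hβ2
  · simp only [CESTransformed.solve, CESParams.transformed, hlθ, hlI, hmθ, hmI, one_mul, zero_add]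
    ext
    · rename_i t m
      have := hl t
      simp only; field_simp; ring
    · rename_i t m
      exact mul_div_cancel_right₀ _ (hl t)
    · rename_i t m
      have h1 := hl t.castSucc
      have h2 := hexpθ t
      have h3 := hexpI t
      simp only; field_simp; ring
    · rename_i t m
      exact mul_div_cancel_right₀ _ (div_ne_zero (mul_ne_zero (hexpθ t) (hl _)) (hexpI t))
    · simp only; field_simp; ring
    · simp only; field_simp
    · rename_i t
      have h1 := hl t.castSucc
      have h2 := hexpθ t
      have h3 := hexpI t
      simp only; field_simp; ring
    · rename_i t
      have h1 := hl t.castSucc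
      have h2 := hexpθ t
      have h3 := hexpI t
      simp only; field_simp
    · rename_i t
      exact mul_div_cancel₀ _ (div_ne_zero (mul_ne_zero (hexpθ t) (hl _)) (hexpI t))
    · exact div_mul_cancel₀ _ (Real.exp_pos _).ne'
    · exact div_mul_cancel₀ _ (Real.exp_pos _).ne'
    · rename_i t
      exact mul_div_cancel_right₀ _ (hl _)
    · rename_i t
      exact div_div_cancel₀ (mul_ne_zero (hexpθ t) (hl _))
    · rename_i t
      have h1 := hl t.castSucc
      have h2 := hl t.succ
      have h3 := hexpθ t
      simp only; field_simp
  · simp [CESTransformed.solve, hmθ, hlθ]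
  · simp [CESTransformed.solve, hmI, hlI]
  · simp [CESTransformed.solve, hlθ]

end CESParams.Admissible

-- The identified set.

theorem theorem3 {T : ℕ} {Ω : Type} [MeasurableSpace Ω] [StandardBorelSpace Ω]
    (μ : Measure Ω) [IsProbabilityMeasure μ] (v : SkillVars T Ω) (p₀ : CESParams T)
    (hp₀ : p₀.Admissible) (heq : v.Equations p₀) (hA : BaselineAssumption v μ) :
    identifiedSet (μ.map (v.observed p₀)) =
        {p | p.Admissible ∧ p.transformed = p₀.transformed} ∧
    (∀ t : Fin T,
      (fun p : CESParams T => p.lamθ t.castSucc 0 / p.lamI t 0) ''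
          identifiedSet (μ.map (v.observed p₀)) =
        {p₀.lamθ t.castSucc 0 / p₀.lamI t 0}) ∧
    (∀ (muθbar : Fin (T + 1) → ℝ) (muIbar : Fin T → ℝ) (lamθbar : Fin (T + 1) → ℝ),
      (∀ t, lamθbar t ≠ 0) →
      ∃ p : CESParams T,
        identifiedSet (μ.map (v.observed p₀)) ∩
          {q | (∀ t, q.muθ t 0 = muθbar t) ∧ (∀ t, q.muI t 0 = muIbar t) ∧
            (∀ t, q.lamθ t 0 = lamθbar t)} = {p}) := by
  have hset : identifiedSet (μ.map (v.observed p₀)) =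
      {p | p.Admissible ∧ p.transformed = p₀.transformed} := by
    ext p
    constructor
    · rintro ⟨hp, Ω', _, _, μ', _, v', heq', hA', hobs⟩
      exact ⟨hp, hA'.transformed_eq hA heq' heq hp hp₀ hobs⟩
    · rintro ⟨hp, h⟩
      exact ⟨hp, Ω, _, inferInstance, μ, inferInstance, v.rescale p₀ p,
        SkillVars.rescale_equations hp₀ hp h heq, hA.rescale hp₀ hp,
        by rw [SkillVars.rescale_observed hp₀ hp h]⟩
  refine ⟨hset, fun t => ?_, fun muθbar muIbar lamθbar hl => ?_⟩
  -- `σ` cancels from the quotient of the two transformed exponents.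
  · have ratio : ∀ p : CESParams T, p.Admissible →
        p.lamθ t.castSucc 0 / p.lamI t 0 = p.transformed.expI t / p.transformed.expθ t := by
      intro p hp
      have h1 := hp.lamθ_ne t.castSucc 0
      have h2 := hp.lamI_ne t 0
      have h3 := hp.σ_ne t
      simp only [CESParams.transformed]
      field_simp
    rw [hset]
    ext x
    constructor
    · rintro ⟨p, ⟨hp, h⟩, rfl⟩
      simp only [Set.mem_singleton_iff]
      rw [ratio p hp, ratio p₀ hp₀, h]
    · rintro rfl
      exact ⟨p₀, ⟨hp₀, rfl⟩, rfl⟩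
  · obtain ⟨h1, h2, h3⟩ := hp₀.transformed_solve (muθbar := muθbar) (muIbar := muIbar) hl
    refine ⟨p₀.transformed.solve muθbar muIbar lamθbar, ?_⟩
    rw [hset]
    ext q
    constructor
    · rintro ⟨⟨hq, hqt⟩, e1, e2, e3⟩
      have := hq.solve_transformed
      rw [hqt, funext e1, funext e2, funext e3] at this
      exact this.symm
    · rintro rfl
      exact ⟨⟨h1, h2⟩, h3⟩
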